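/- Let $N\ge 1$ and let $\alpha,\eta,\theta,R$ be real $N\times N$ matrices with $\alpha^{T}=\alpha>0$, $\eta^{T}=\eta>0$ (the duality condition), $\theta^{T}=-\theta$, $R^{T}=R\ge 0$, and $N_R:=\operatorname{rank}R>0$. For $\beta\ge 0$ consider the system operator of the Lagrangian system $\alpha\ddot Q+(2\theta+\beta R)\dot Q+\eta Q=0$, i.e. the $2N\times 2N$ matrix $$A(\beta)=\Omega-\mathrm{i}\beta B,\qquad \Omega=\begin{bmatrix}-2\mathrm{i}K_p\theta K_p^{T}&-\mathrm{i}\Phi^{T}\\ \mathrm{i}\Phi&0\end{bmatrix},\quad B=\begin{bmatrix}K_pRK_p^{T}&0\\0&0\end{bmatrix},$$ where $K_p=\sqrt{\alpha}^{\,-1}$, $K_q=\sqrt{\eta}$, $\Phi=K_qK_p^{T}$. By high-loss-regime eigenpairs of $A(\beta)$ we mean functions $\zeta_j(\beta)\in\mathbb C$, $w_j(\beta)\in\mathbb C^{2N}$, $1\le j\le 2N$, such that for all sufficiently large $\beta$ the vectors $w_1(\beta),\dots,w_{2N}(\beta)$ form a basis of $\mathbb C^{2N}$ with $A(\beta)w_j(\beta)=\zeta_j(\beta)w_j(\beta)$,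 all $w_j$ are analytic in $\beta^{-1}$ at $\beta=\infty$, the eigenvalues $\zeta_j$ with $1\le j\le N_R$ (high-loss) have a pole at $\beta=\infty$, and the eigenvalues $\zeta_j$ with $N_R+1\le j\le 2N$ (low-loss) are analytic in $\beta^{-1}$ at $\beta=\infty$. Then, counted with algebraic multiplicity, $\eta^{-1}R$ has exactly $N_R$ nonzero complex eigenvalues, all of them positive real numbers; list them, repeated according to their multiplicities, as $0<b_1^{\flat}\le\dots\le b_{N_R}^{\flat}$. High-loss-regime eigenpairs of $A(\beta)$ exist, and any such family can be reindexed, by a permutation of $\{1,\dots,2N\}$ that fixes $1,\dots,N_R$, so that afterwards $$\zeta_j(\beta)\to 0\quad\text{and}\quad \zeta_j(\beta)=-\mathrm{i}\,\frac{1}{b^{\flat}_{j-N_R}}\,\beta^{-1}+O(\beta^{-2})\quad(\beta\to\infty),\qquad N_R+1\le j\le 2N_R,$$ while for $2N_R+1\le j\le 2N$ the limit $\lim_{\beta\to\infty}\zeta_j(\beta)$ exists and is a nonzero real number. -/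

import Mathlib

open Filter Asymptotics
open scoped Matrix MatrixOrder Topology

noncomputable section

/-- Entrywise complexification of a real matrix. -/
def complexify {m n : Type*} (M : Matrix m n ℝ) : Matrix m n ℂ := M.map Complex.ofReal

/-- `K_p`, the inverse of the positive definite square root of `α`. -/
def Kp {N : ℕ} (α : Matrix (Fin N) (Fin N) ℝ) : Matrix (Fin N) (Fin N) ℝ := (CFC.sqrt α)⁻¹

/-- `K_q`, the positive semidefinite square root of `η`. -/
def Kq {N : ℕ} (η : Matrix (Fin N) (Fin N) ℝ) : Matrix (Fin N) (Fin N) ℝ := CFC.sqrt η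

/-- `Φ = K_q K_pᵀ`. -/
def Phi {N : ℕ} (α η : Matrix (Fin N) (Fin N) ℝ) : Matrix (Fin N) (Fin N) ℝ := Kq η * (Kp α)ᵀ

/-- The frequency operator `Ω = [[-2i K_p θ K_pᵀ, -i Φᵀ], [i Φ, 0]]`. -/
def frequencyOperator {N : ℕ} (α η θ : Matrix (Fin N) (Fin N) ℝ) :
    Matrix (Fin N ⊕ Fin N) (Fin N ⊕ Fin N) ℂ :=
  Matrix.fromBlocks ((-2 * Complex.I) • complexify (Kp α * θ * (Kp α)ᵀ))
    ((-Complex.I) • complexify (Phi α η)ᵀ) (Complex.I • complexify (Phi α η)) 0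

/-- The power dissipation operator `B = [[K_p R K_pᵀ, 0], [0, 0]]`. -/
def dissipationOperator {N : ℕ} (α R : Matrix (Fin N) (Fin N) ℝ) :
    Matrix (Fin N ⊕ Fin N) (Fin N ⊕ Fin N) ℂ :=
  Matrix.fromBlocks (complexify (Kp α * R * (Kp α)ᵀ)) 0 0 0

/-- The system operator `A(β) = Ω - i β B` of the Lagrangian system
`α Q'' + (2 θ + β R) Q' + η Q = 0`. -/
def systemOperator {N : ℕ} (α η θ R : Matrix (Fin N) (Fin N) ℝ) (β : ℝ) :
    Matrix (Fin N ⊕ Fin N) (Fin N ⊕ Fin N) ℂ :=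
  frequencyOperator α η θ - (Complex.I * (β : ℂ)) • dissipationOperator α R

/-- `f` is analytic at `β = ∞`: for large `β` it is given by a convergent power series in
`β⁻¹`. -/
def AnalyticAtInfty {E : Type*} [NormedAddCommGroup E] [NormedSpace ℂ E] (f : ℝ → E) : Prop :=
  ∃ g : ℂ → E, AnalyticAt ℂ g 0 ∧ ∀ᶠ β : ℝ in atTop, f β = g ((β : ℂ)⁻¹)

/-- `f` has a pole at `β = ∞`: for large `β` it is given by a convergent Laurent series in
`β⁻¹` with finitely many, and at least one, negative powers of `β⁻¹`. -/
def HasPoleAtInfty (f : ℝ → ℂ) : Prop :=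
  ∃ g : ℂ → ℂ, MeromorphicAt g 0 ∧ meromorphicOrderAt g 0 < 0 ∧
    ∀ᶠ β : ℝ in atTop, f β = g ((β : ℂ)⁻¹)

/-- `(ζ j, w j)`, `0 ≤ j < 2N`, are the eigenpairs of the system operator in the high-loss regime:
for large `β` the `w j β` are a basis of `ℂ²ᴺ` consisting of eigenvectors of `A(β)` with
eigenvalues `ζ j β`, all eigenvectors are analytic at `β = ∞`, the first `N_R = rank R` eigenvalues
(the high-loss ones) have a pole at `β = ∞`, and the other ones (the low-loss ones) are analytic
at `β = ∞`. -/
structure IsHighLossEigenbasis {N : ℕ} (α η θ R : Matrix (Fin N) (Fin N) ℝ)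
    (ζ : Fin (2 * N) → ℝ → ℂ) (w : Fin (2 * N) → ℝ → Fin N ⊕ Fin N → ℂ) : Prop where
  basis : ∀ᶠ β : ℝ in atTop, LinearIndependent ℂ (fun j => w j β) ∧
    Submodule.span ℂ (Set.range fun j => w j β) = ⊤
  eigen : ∀ᶠ β : ℝ in atTop, ∀ j, systemOperator α η θ R β *ᵥ w j β = ζ j β • w j β
  analytic_vec : ∀ j, AnalyticAtInfty (w j)
  highLoss : ∀ j : Fin (2 * N), (j : ℕ) < R.rank → HasPoleAtInfty (ζ j)
  lowLoss : ∀ j : Fin (2 * N), R.rank ≤ (j : ℕ) → AnalyticAtInfty (ζ j)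

/-- `b` lists all nonzero (complex) eigenvalues of the real square matrix `M`, which are therefore
real, in increasing order and repeated according to their algebraic multiplicities. -/
def ListsNonzeroEigenvalues {N r : ℕ} (M : Matrix (Fin N) (Fin N) ℝ) (b : Fin r → ℝ) : Prop :=
  Monotone b ∧
    Finset.univ.val.map (fun k => (b k : ℂ)) =
      (complexify M).charpoly.roots.filter (fun x => x ≠ 0)

end

/-! Eigenvalues of `η⁻¹ * R`: this matrix has the characteristic polynomial of the positive
semidefinite matrix `η^(-1/2) R η^(-1/2)`, which has the rank of `R`.

Existence: `A(β) = -iβ T(i/β)` with `T(z) = B + zΩ`, and `T` is Hermitian at real `z`. Rellich's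
theorem (`exists_analytic_eigenbasis`) gives analytic eigenvalues `μ_i` and eigenvectors of `T` near
`0`, and `ζ = -iβ μ(i/β)` has a pole or is analytic at infinity according to whether `μ(0) ≠ 0` or
`μ(0) = 0`. The number of nonzero `μ_i(0)` is the rank of `B`, which is that of `R`. Rellich's
theorem is proved for monic polynomials first (`AnalyticFamily.analyticallySplits`): center the
roots, rescale until the polynomial at `0` is no pure power, split it by Hensel's lemma, and induct
on the degree.

Asymptotics (`IsHighLossEigenbasis.exists_equiv`): by a Schur complement, the characteristic
polynomial of `A(β)` at `μ/β` tends to a nonzero constant times `det(iμR - η)`, whose roots are the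
`-i/b_k`. It also equals the product of the `μ/β - ζ_j(β)`. After scaling by suitable powers of `β`,
the factors with `ζ_j → 0` tend to `μ - c_j`, where `c_j` is the coefficient of `1/β` in `ζ_j`, and
all others tend to nonzero constants. Comparing the two limits, the total power of `β` is zero and
the `c_j` are the `-i/b_k` with multiplicity. In particular exactly `R.rank` of the low-loss
eigenvalues vanish in the limit.

Real limits (`IsHighLossEigenbasis.limit_real`): a limiting eigenvector `u` lies in the kernel of
`B`, so the limit is the Rayleigh quotient of the Hermitian matrix `Ω` at `u`. -/

noncomputable section

/-! ### Hensel's lemma for analytic families of monic polynomials -/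

section AnalyticFactorization
open Polynomial

/-- A family of polynomials whose coefficients are analytic at `0`. -/
def AnalyticFamily (f : ℂ → ℂ[X]) : Prop := ∀ k, AnalyticAt ℂ (fun z => (f z).coeff k) 0

/-- The polynomial of degree less than `p` with prescribed coefficients. -/
def ofCoeffs (p : ℕ) : (Fin p → ℂ) →ₗ[ℂ] ℂ[X] :=
  ∑ i : Fin p, (Polynomial.monomial (i : ℕ)).comp (LinearMap.proj i)

lemma ofCoeffs_coeff {p : ℕ} (a : Fin p → ℂ) (k : ℕ) :
    (ofCoeffs p a).coeff k = if h : k < p then a ⟨k, h⟩ else 0 := by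
  simp only [ofCoeffs, LinearMap.coe_sum, Finset.sum_apply, LinearMap.comp_apply,
    LinearMap.proj_apply, Polynomial.finsetSum_coeff, Polynomial.coeff_monomial]
  split_ifs with h
  · rw [Finset.sum_eq_single ⟨k, h⟩]
    · simp
    · intro b _ hb
      rw [if_neg]
      rintro rfl
      exact hb rfl
    · simp
  · exact Finset.sum_eq_zero fun i _ => if_neg fun (hi : (i : ℕ) = k) => h (hi ▸ i.2)

lemma ofCoeffs_degree_lt {p : ℕ} (a : Fin p → ℂ) : (ofCoeffs p a).degree < p := by
  rw [Polynomial.degree_lt_iff_coeff_zero]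
  intro m hm
  rw [ofCoeffs_coeff, dif_neg (by omega)]

lemma ofCoeffs_eq_zero {p : ℕ} {a : Fin p → ℂ} (h : ofCoeffs p a = 0) : a = 0 := by
  ext i
  have := congrArg (fun P : ℂ[X] => P.coeff i) h
  simpa [ofCoeffs_coeff] using this

lemma X_pow_add_ofCoeffs {f : ℂ[X]} {n : ℕ} (hf : f.Monic) (hn : f.natDegree = n) :
    X ^ n + ofCoeffs n (fun i => f.coeff i) = f := by
  ext k
  rw [Polynomial.coeff_add, Polynomial.coeff_X_pow, ofCoeffs_coeff]
  rcases lt_trichotomy k n with h | h | h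
  · simp [h, h.ne]
  · subst h; subst hn; simp [hf.coeff_natDegree]
  · simp [h.ne', h.not_gt, Polynomial.coeff_eq_zero_of_natDegree_lt (hn ▸ h)]

lemma monic_X_pow_add_ofCoeffs {p : ℕ} (a : Fin p → ℂ) : (X ^ p + ofCoeffs p a).Monic :=
  Polynomial.monic_X_pow_add (ofCoeffs_degree_lt a)

lemma natDegree_X_pow_add_ofCoeffs {p : ℕ} (a : Fin p → ℂ) :
    (X ^ p + ofCoeffs p a).natDegree = p := by
  apply Polynomial.natDegree_eq_of_degree_eq_some
  rw [Polynomial.degree_add_eq_left_of_degree_lt, Polynomial.degree_X_pow]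
  rw [Polynomial.degree_X_pow]
  exact ofCoeffs_degree_lt a

/-- Multiplication of monic polynomials in terms of their lower coefficients. -/
def mulCoeffs (p q : ℕ) (x : (Fin p → ℂ) × (Fin q → ℂ)) : Fin (p + q) → ℂ :=
  fun i => ((X ^ p + ofCoeffs p x.1) * (X ^ q + ofCoeffs q x.2)).coeff i

lemma contDiff_mulCoeffs (p q : ℕ) : ContDiff ℂ ⊤ (mulCoeffs p q) := by
  rw [contDiff_pi]
  intro i
  simp only [mulCoeffs, Polynomial.coeff_mul, Polynomial.coeff_add, ofCoeffs_coeff]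
  refine ContDiff.sum fun k _ => ContDiff.mul (contDiff_const.add ?_) (contDiff_const.add ?_)
  · split_ifs
    · fun_prop
    · exact contDiff_const
  · split_ifs
    · fun_prop
    · exact contDiff_const

/-- Along a line the product of the two monic polynomials is quadratic in `t`, so the derivative is
read off from the linear term. -/
lemma mulCoeffs_line {p q : ℕ} (x d : (Fin p → ℂ) × (Fin q → ℂ)) (i : Fin (p + q)) :
    HasDerivAt (fun t : ℂ => mulCoeffs p q (x + t • d) i)
      ((ofCoeffs p d.1 * (X ^ q + ofCoeffs q x.2) +
        (X ^ p + ofCoeffs p x.1) * ofCoeffs q d.2).coeff i) 0 := by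
  have key : ∀ t : ℂ, mulCoeffs p q (x + t • d) i = mulCoeffs p q x i +
      t * (ofCoeffs p d.1 * (X ^ q + ofCoeffs q x.2) +
        (X ^ p + ofCoeffs p x.1) * ofCoeffs q d.2).coeff i +
      t ^ 2 * (ofCoeffs p d.1 * ofCoeffs q d.2).coeff i := by
    intro t
    simp only [mulCoeffs, ← Polynomial.coeff_C_mul, ← Polynomial.coeff_add]
    congr 1
    simp only [Prod.fst_add, Prod.snd_add, Prod.smul_fst, Prod.smul_snd, map_add, map_smul,
      Polynomial.smul_eq_C_mul, Polynomial.C_pow]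
    ring
  simp only [key]
  set c₁ := (ofCoeffs p d.1 * (X ^ q + ofCoeffs q x.2) +
        (X ^ p + ofCoeffs p x.1) * ofCoeffs q d.2).coeff i
  set c₂ := (ofCoeffs p d.1 * ofCoeffs q d.2).coeff i
  have h1 := ((hasDerivAt_id (0 : ℂ)).mul_const c₁)
  have h2 := ((hasDerivAt_pow 2 (0 : ℂ)).mul_const c₂)
  have h3 := (h1.const_add (mulCoeffs p q x i)).add h2
  simpa [Pi.add_def] using h3

/-- A kernel vector gives polynomials with `u * Q + P * v = 0`, `deg u < p` and `deg v < q`.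
Coprimality makes `P` divide `u`, which forces `u = 0` and then `v = 0`. -/
lemma fderiv_mulCoeffs_injective {p q : ℕ} (x : (Fin p → ℂ) × (Fin q → ℂ))
    (hx : IsCoprime (X ^ p + ofCoeffs p x.1) (X ^ q + ofCoeffs q x.2)) :
    Function.Injective (fderiv ℂ (mulCoeffs p q) x) := by
  rw [injective_iff_map_eq_zero]
  intro d hd
  have hdiff : DifferentiableAt ℂ (mulCoeffs p q) x :=
    (contDiff_mulCoeffs p q).differentiable (by simp) x
  have hcoef : ∀ i : Fin (p + q), (ofCoeffs p d.1 * (X ^ q + ofCoeffs q x.2) +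
        (X ^ p + ofCoeffs p x.1) * ofCoeffs q d.2).coeff i = 0 := by
    intro i
    have hl : HasDerivAt (fun t : ℂ => x + t • d) d 0 := by
      simpa using ((hasDerivAt_id (0 : ℂ)).smul_const d).const_add x
    have h1 : HasFDerivAt (mulCoeffs p q) (fderiv ℂ (mulCoeffs p q) x) (x + (0 : ℂ) • d) := by
      simpa using hdiff.hasFDerivAt
    have h2 := h1.comp_hasDerivAt (0 : ℂ) hl
    rw [hd] at h2
    exact (mulCoeffs_line x d i).unique ((hasDerivAt_pi.1 h2) i)
  set P := X ^ p + ofCoeffs p x.1 with hP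
  set Q := X ^ q + ofCoeffs q x.2 with hQ
  have hPm : P.Monic := monic_X_pow_add_ofCoeffs x.1
  have hQm : Q.Monic := monic_X_pow_add_ofCoeffs x.2
  have hPd : P.degree = p := by
    rw [Polynomial.degree_eq_natDegree hPm.ne_zero, natDegree_X_pow_add_ofCoeffs]
  have hQd : Q.degree = q := by
    rw [Polynomial.degree_eq_natDegree hQm.ne_zero, natDegree_X_pow_add_ofCoeffs]
  have hz : ofCoeffs p d.1 * Q + P * ofCoeffs q d.2 = 0 := by
    have hdeg : (ofCoeffs p d.1 * Q + P * ofCoeffs q d.2).degree < ((p + q : ℕ) : WithBot ℕ) := by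
      refine (Polynomial.degree_add_le _ _).trans_lt (max_lt ?_ ?_)
      · rw [hQm.degree_mul, hQd, Nat.cast_add]
        exact WithBot.add_lt_add_right (by simp) (ofCoeffs_degree_lt d.1)
      · rw [mul_comm, hPm.degree_mul, hPd, Nat.cast_add, add_comm (p : WithBot ℕ)]
        exact WithBot.add_lt_add_right (by simp) (ofCoeffs_degree_lt d.2)
    ext k
    by_cases hk : k < p + q
    · exact hcoef ⟨k, hk⟩
    · rw [Polynomial.coeff_eq_zero_of_degree_lt]
      · simp
      · exact hdeg.trans_le (by exact_mod_cast not_lt.1 hk)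
  have hu : ofCoeffs p d.1 = 0 := by
    apply Polynomial.eq_zero_of_dvd_of_degree_lt (p := P)
    · refine hx.dvd_of_dvd_mul_right ?_
      exact ⟨-ofCoeffs q d.2, by linear_combination hz⟩
    · rw [hPd]; exact ofCoeffs_degree_lt d.1
  have hv : ofCoeffs q d.2 = 0 := by
    rw [hu, zero_mul, zero_add] at hz
    exact (mul_eq_zero.1 hz).resolve_left hPm.ne_zero
  exact Prod.ext (ofCoeffs_eq_zero hu) (ofCoeffs_eq_zero hv)

lemma analyticFamily_X_pow_add_ofCoeffs {p : ℕ} {a : ℂ → Fin p → ℂ} (ha : AnalyticAt ℂ a 0) :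
    AnalyticFamily fun z => X ^ p + ofCoeffs p (a z) := by
  intro k
  simp only [Polynomial.coeff_add, ofCoeffs_coeff]
  refine analyticAt_const.add ?_
  split_ifs with h
  · exact (analyticAt_pi_iff.1 ha) ⟨k, h⟩
  · exact analyticAt_const

/-- Hensel's lemma for analytic families of monic polynomials. -/
theorem AnalyticFamily.exists_factorization {f : ℂ → ℂ[X]} (hf : AnalyticFamily f) {g₀ h₀ : ℂ[X]}
    (hg₀ : g₀.Monic) (hh₀ : h₀.Monic) (hco : IsCoprime g₀ h₀) (h0 : f 0 = g₀ * h₀)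
    (hfm : ∀ᶠ z in 𝓝 0, (f z).Monic ∧ (f z).natDegree = g₀.natDegree + h₀.natDegree) :
    ∃ g h : ℂ → ℂ[X], AnalyticFamily g ∧ AnalyticFamily h ∧
      (∀ z, (g z).Monic ∧ (g z).natDegree = g₀.natDegree) ∧
      (∀ z, (h z).Monic ∧ (h z).natDegree = h₀.natDegree) ∧ ∀ᶠ z in 𝓝 0, f z = g z * h z := by
  set p := g₀.natDegree with hp
  set q := h₀.natDegree with hq
  set x : (Fin p → ℂ) × (Fin q → ℂ) := (fun i => g₀.coeff i, fun i => h₀.coeff i) with hx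
  have hg : X ^ p + ofCoeffs p x.1 = g₀ := X_pow_add_ofCoeffs hg₀ rfl
  have hh : X ^ q + ofCoeffs q x.2 = h₀ := X_pow_add_ofCoeffs hh₀ rfl
  have hcd : ContDiffAt ℂ ⊤ (mulCoeffs p q) x := (contDiff_mulCoeffs p q).contDiffAt
  have hinj : Function.Injective (fderiv ℂ (mulCoeffs p q) x) :=
    fderiv_mulCoeffs_injective x (by rw [hg, hh]; exact hco)
  -- Source and target both have dimension `p + q`, so the injective derivative is invertible and
  -- the inverse function theorem lifts the coefficients of `f z` to those of the factors.
  let e : ((Fin p → ℂ) × (Fin q → ℂ)) ≃L[ℂ] (Fin (p + q) → ℂ) :=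
    (LinearEquiv.ofInjectiveOfFinrankEq (fderiv ℂ (mulCoeffs p q) x).toLinearMap hinj
      (by simp)).toContinuousLinearEquiv
  have he : (e : ((Fin p → ℂ) × (Fin q → ℂ)) →L[ℂ] (Fin (p + q) → ℂ)) =
      fderiv ℂ (mulCoeffs p q) x := by
    exact ContinuousLinearMap.ext fun v => rfl
  have hfd : HasFDerivAt (mulCoeffs p q)
      (e : ((Fin p → ℂ) × (Fin q → ℂ)) →L[ℂ] (Fin (p + q) → ℂ)) x := by
    rw [he]
    exact ((contDiff_mulCoeffs p q).differentiable (by simp) x).hasFDerivAt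
  have hstrict := hcd.hasStrictFDerivAt' hfd (by simp)
  have hright := hstrict.eventually_right_inverse
  have hloc : AnalyticAt ℂ (hstrict.localInverse _ _ _) (mulCoeffs p q x) :=
    (hcd.to_localInverse hfd (by simp)).analyticAt
  set F : ℂ → Fin (p + q) → ℂ := fun z i => (f z).coeff i with hF
  have hF0 : F 0 = mulCoeffs p q x := by
    ext i
    simp only [hF, mulCoeffs, hg, hh, h0]
  have hFa : AnalyticAt ℂ F 0 := analyticAt_pi_iff.2 fun i => hf i
  rw [← hF0] at hloc hright
  have hGa : AnalyticAt ℂ (fun z => hstrict.localInverse _ _ _ (F z)) 0 := hloc.comp hFa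
  refine ⟨fun z => X ^ p + ofCoeffs p (hstrict.localInverse _ _ _ (F z)).1,
    fun z => X ^ q + ofCoeffs q (hstrict.localInverse _ _ _ (F z)).2,
    analyticFamily_X_pow_add_ofCoeffs (analyticAt_fst.comp hGa),
    analyticFamily_X_pow_add_ofCoeffs (analyticAt_snd.comp hGa),
    fun z => ⟨monic_X_pow_add_ofCoeffs _, natDegree_X_pow_add_ofCoeffs _⟩,
    fun z => ⟨monic_X_pow_add_ofCoeffs _, natDegree_X_pow_add_ofCoeffs _⟩, ?_⟩
  filter_upwards [hfm, hFa.continuousAt.eventually hright] with z hz hzr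
  set y := hstrict.localInverse _ _ _ (F z)
  have hm : ((X ^ p + ofCoeffs p y.1) * (X ^ q + ofCoeffs q y.2)).Monic :=
    (monic_X_pow_add_ofCoeffs _).mul (monic_X_pow_add_ofCoeffs _)
  have hd : ((X ^ p + ofCoeffs p y.1) * (X ^ q + ofCoeffs q y.2)).natDegree = p + q := by
    rw [(monic_X_pow_add_ofCoeffs y.1).natDegree_mul (monic_X_pow_add_ofCoeffs _),
      natDegree_X_pow_add_ofCoeffs, natDegree_X_pow_add_ofCoeffs]
  rw [← X_pow_add_ofCoeffs hz.1 hz.2, ← X_pow_add_ofCoeffs hm hd]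
  congr 2
  exact hzr.symm

end AnalyticFactorization

/-! ### Rellich's theorem for real-rooted polynomial families -/

section AnalyticRoots
open Polynomial

/-- The map `ℝ → ℂ` respects punctured neighbourhoods of `0`. -/
lemma tendsto_ofReal_punctured :
    Tendsto (fun x : ℝ => (x : ℂ)) (𝓝[≠] 0) (𝓝[≠] 0) := by
  refine tendsto_nhdsWithin_iff.2 ⟨?_, ?_⟩
  · exact (Complex.continuous_ofReal.tendsto' 0 0 (by simp)).mono_left nhdsWithin_le_nhds
  · filter_upwards [self_mem_nhdsWithin] with x hx
    simpa using hx

lemma AnalyticAt.eventually_zero_of_real {E : Type*} [NormedAddCommGroup E] [NormedSpace ℂ E]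
    {a : ℂ → E} (ha : AnalyticAt ℂ a 0) (h : ∀ᶠ x : ℝ in 𝓝[≠] 0, a x = 0) :
    ∀ᶠ z in 𝓝 0, a z = 0 :=
  ha.frequently_zero_iff_eventually_zero.1 (tendsto_ofReal_punctured.frequently h.frequently)

/-- The order of vanishing can be tested on the real axis: if it were `n < m`, the cofactor `g`
would be `O(|x| ^ (m - n))` there, against `g 0 ≠ 0`. -/
lemma AnalyticAt.exists_eq_pow_mul_of_bound {b : ℂ → ℂ} (hb : AnalyticAt ℂ b 0) {m : ℕ} {K : ℝ}
    (h : ∀ᶠ x : ℝ in 𝓝[≠] 0, ‖b x‖ ≤ K * |x| ^ m) :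
    ∃ g : ℂ → ℂ, AnalyticAt ℂ g 0 ∧ ∀ᶠ z in 𝓝 0, b z = z ^ m * g z := by
  by_cases hz : ∀ᶠ z in 𝓝 0, b z = 0
  · exact ⟨0, analyticAt_const, by filter_upwards [hz] with z hz; simp [hz]⟩
  obtain ⟨n, g, hg, hg0, hbg⟩ := hb.exists_eventuallyEq_pow_smul_nonzero_iff.2 hz
  simp only [sub_zero, smul_eq_mul] at hbg
  rcases le_or_gt m n with hmn | hmn
  · refine ⟨fun z => z ^ (n - m) * g z, by fun_prop, ?_⟩
    filter_upwards [hbg] with z hz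
    rw [hz, ← mul_assoc, ← pow_add, Nat.add_sub_cancel' hmn]
  · exfalso
    apply hg0
    have h1 : Tendsto (fun x : ℝ => g x) (𝓝[≠] 0) (𝓝 (g 0)) :=
      hg.continuousAt.tendsto.comp (tendsto_ofReal_punctured.mono_right nhdsWithin_le_nhds)
    have h2 : Tendsto (fun x : ℝ => g x) (𝓝[≠] 0) (𝓝 0) := by
      refine squeeze_zero_norm' (a := fun x => K * |x| ^ (m - n)) ?_ ?_
      · filter_upwards [h, (tendsto_ofReal_punctured.mono_right nhdsWithin_le_nhds).eventually hbg,
          self_mem_nhdsWithin] with x hx hx' hx0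
        have hx0 : 0 < |x| := abs_pos.2 hx0
        rw [hx', norm_mul, norm_pow, Complex.norm_real, Real.norm_eq_abs,
          ← Nat.add_sub_cancel' hmn.le, pow_add] at hx
        have : |x| ^ n * ‖g x‖ ≤ |x| ^ n * (K * |x| ^ (m - n)) := by linarith
        exact le_of_mul_le_mul_left this (by positivity)
      · have : Continuous fun x : ℝ => K * |x| ^ (m - n) := by fun_prop
        refine (this.tendsto' 0 0 ?_).mono_left nhdsWithin_le_nhds
        simp [Nat.sub_ne_zero_of_lt hmn]
    exact tendsto_nhds_unique h1 h2

/-- An odd order would make the leading term change sign at `0` along the real axis. -/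
lemma AnalyticAt.exists_even_order_of_nonpos {a : ℂ → ℂ} (ha : AnalyticAt ℂ a 0)
    (hz : ¬ ∀ᶠ z in 𝓝 0, a z = 0)
    (h : ∀ᶠ x : ℝ in 𝓝[≠] 0, (a x).re ≤ 0 ∧ (a x).im = 0) :
    ∃ (r : ℕ) (u : ℂ → ℂ), AnalyticAt ℂ u 0 ∧ u 0 ≠ 0 ∧ ∀ᶠ z in 𝓝 0, a z = z ^ (2 * r) * u z := by
  obtain ⟨n, u, hu, hu0, hau⟩ := ha.exists_eventuallyEq_pow_smul_nonzero_iff.2 hz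
  simp only [sub_zero, smul_eq_mul] at hau
  rcases Nat.even_or_odd n with ⟨r, hr⟩ | hodd
  · exact ⟨r, u, hu, hu0, by rwa [two_mul, ← hr]⟩
  exfalso
  have hlim : Tendsto (fun x : ℝ => u x) (𝓝[≠] 0) (𝓝 (u 0)) :=
    hu.continuousAt.tendsto.comp (tendsto_ofReal_punctured.mono_right nhdsWithin_le_nhds)
  have hau' := (tendsto_ofReal_punctured.mono_right nhdsWithin_le_nhds).eventually hau
  have key : ∀ᶠ x : ℝ in 𝓝[≠] 0, x ^ n * (u x).re ≤ 0 ∧ x ^ n * (u x).im = 0 := by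
    filter_upwards [h, hau'] with x hx hx'
    rw [hx', ← Complex.ofReal_pow, Complex.re_ofReal_mul, Complex.im_ofReal_mul] at hx
    exact hx
  have hpos : (𝓝[>] (0 : ℝ)) ≤ 𝓝[≠] 0 := nhdsWithin_mono _ fun x hx => ne_of_gt hx
  have hneg : (𝓝[<] (0 : ℝ)) ≤ 𝓝[≠] 0 := nhdsWithin_mono _ fun x hx => ne_of_lt hx
  have him : (u 0).im = 0 := by
    refine tendsto_nhds_unique ((Complex.continuous_im.tendsto _).comp hlim)
      (tendsto_const_nhds.congr' ?_)
    filter_upwards [key, self_mem_nhdsWithin] with x hx hx0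
    exact ((mul_eq_zero.1 hx.2).resolve_left (pow_ne_zero _ hx0)).symm
  have hre : (u 0).re ≤ 0 := by
    refine le_of_tendsto ((Complex.continuous_re.tendsto _).comp (hlim.mono_left hpos)) ?_
    filter_upwards [hpos key, self_mem_nhdsWithin] with x hx hx0
    have : 0 < x ^ n := pow_pos hx0 n
    simp only [Function.comp]
    nlinarith [hx.1]
  have hre' : 0 ≤ (u 0).re := by
    refine ge_of_tendsto ((Complex.continuous_re.tendsto _).comp (hlim.mono_left hneg)) ?_
    filter_upwards [hneg key, self_mem_nhdsWithin] with x hx hx0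
    have : x ^ n < 0 := hodd.pow_neg hx0
    simp only [Function.comp]
    nlinarith [hx.1]
  exact hu0 (Complex.ext (le_antisymm hre hre') him)

lemma Multiset.two_mul_esymm_two {R : Type*} [CommRing R] (s : Multiset R) :
    2 * s.esymm 2 = s.sum ^ 2 - (s.map (· ^ 2)).sum := by
  induction s using Multiset.induction_on with
  | empty => simp [Multiset.esymm, Multiset.powersetCard_zero_right]
  | cons a s ih =>
    have : (a ::ₘ s).esymm 2 = s.esymm 2 + a * s.sum := by
      have := Multiset.sum_map_mul_left (s := s) (a := a) (f := fun x => x)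
      simpa [Multiset.esymm, Multiset.powersetCard_cons 1, Multiset.powersetCard_one,
        Multiset.map_map] using this
    rw [this, mul_add, ih, Multiset.sum_cons, Multiset.map_cons, Multiset.sum_cons]
    ring

/-- The roots of a real-rooted monic polynomial whose roots add up to `0` are controlled by its
third coefficient. -/
lemma Polynomial.Monic.roots_bound_of_real {p : ℂ[X]} (hp : p.Monic) {m : ℕ}
    (hd : p.natDegree = m + 2) (h1 : p.coeff (m + 1) = 0) (hr : ∀ c ∈ p.roots, c.im = 0) :
    ((p.coeff m).re ≤ 0 ∧ (p.coeff m).im = 0) ∧ ∀ c ∈ p.roots, ‖c‖ ^ 2 ≤ 2 * ‖p.coeff m‖ := by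
  have hs := IsAlgClosed.splits p
  have hcard : p.roots.card = m + 2 := by rw [← hs.natDegree_eq_card_roots, hd]
  have hprod := hs.eq_prod_roots_of_monic hp
  have e1 : p.coeff (m + 1) = -p.roots.sum := by
    conv_lhs => rw [hprod]
    rw [Multiset.prod_X_sub_C_coeff _ (by omega), hcard, show m + 2 - (m + 1) = 1 by omega]
    simp [Multiset.esymm, Multiset.powersetCard_one, Multiset.map_map]
  have e2 : p.coeff m = p.roots.esymm 2 := by
    conv_lhs => rw [hprod]
    rw [Multiset.prod_X_sub_C_coeff _ (by omega), hcard, show m + 2 - m = 2 by omega]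
    simp
  have hsum : p.roots.sum = 0 := by rw [h1] at e1; simpa using e1.symm
  have h2 := Multiset.two_mul_esymm_two p.roots
  rw [hsum, ← e2] at h2
  have hsq : (p.roots.map (· ^ 2)).sum = (((p.roots.map fun c => ‖c‖ ^ 2).sum : ℝ) : ℂ) := by
    rw [← Complex.ofRealHom_eq_coe, map_multiset_sum, Multiset.map_map]
    congr 1
    refine Multiset.map_congr rfl fun c hc => ?_
    have : c = (c.re : ℂ) := Complex.ext rfl (by simpa using hr c hc)
    rw [this]
    simp [sq_abs]
  set S := (p.roots.map fun c => ‖c‖ ^ 2).sum with hS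
  have hco : p.coeff m = ((-(S / 2) : ℝ) : ℂ) := by
    rw [hsq] at h2
    push_cast
    linear_combination h2 / 2
  have hS0 : 0 ≤ S := Multiset.sum_nonneg (by simp; intros; subst_vars; positivity)
  refine ⟨⟨?_, ?_⟩, fun c hc => ?_⟩
  · rw [hco, Complex.ofReal_re]; linarith
  · rw [hco, Complex.ofReal_im]
  · have : ‖c‖ ^ 2 ≤ S := Multiset.single_le_sum (by simp; intros; subst_vars; positivity) _
      (Multiset.mem_map_of_mem (fun c : ℂ => ‖c‖ ^ 2) hc)
    rw [hco, Complex.norm_real, Real.norm_eq_abs, abs_neg, abs_of_nonneg (by positivity)]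
    linarith

/-- All roots of `f x` are real for small real `x ≠ 0`. -/
def RealRooted (f : ℂ → ℂ[X]) : Prop :=
  ∀ᶠ x : ℝ in 𝓝[≠] 0, ∀ c ∈ (f x).roots, c.im = 0

/-- The roots of `f z`, with multiplicities, are analytic functions of `z` near `0`. -/
def AnalyticallySplits (f : ℂ → ℂ[X]) : Prop :=
  ∃ L : Multiset (ℂ → ℂ), (∀ l ∈ L, AnalyticAt ℂ l 0) ∧
    ∀ᶠ z in 𝓝 0, f z = (L.map fun l => X - C (l z)).prod

lemma AnalyticallySplits.mul {f g h : ℂ → ℂ[X]} (hg : AnalyticallySplits g)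
    (hh : AnalyticallySplits h) (hf : ∀ᶠ z in 𝓝 0, f z = g z * h z) : AnalyticallySplits f := by
  obtain ⟨L, hL, hgL⟩ := hg
  obtain ⟨M, hM, hhM⟩ := hh
  refine ⟨L + M, ?_, ?_⟩
  · intro l hl
    exact (Multiset.mem_add.1 hl).elim (hL l) (hM l)
  · filter_upwards [hf, hgL, hhM] with z h1 h2 h3
    rw [h1, h2, h3, Multiset.map_add, Multiset.prod_add]

lemma AnalyticallySplits.of_taylor {f : ℂ → ℂ[X]} {c : ℂ → ℂ} (hc : AnalyticAt ℂ c 0)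
    (h : AnalyticallySplits fun z => taylor (c z) (f z)) : AnalyticallySplits f := by
  obtain ⟨L, hL, hgL⟩ := h
  refine ⟨L.map fun l z => l z + c z, ?_, ?_⟩
  · intro l hl
    obtain ⟨l', hl', rfl⟩ := Multiset.mem_map.1 hl
    exact (hL l' hl').add hc
  · filter_upwards [hgL] with z hz
    have h1 : f z = taylor (-(c z)) (taylor (c z) (f z)) := by simp [taylor_taylor]
    rw [h1, hz, ← taylorAlgHom_apply, map_multiset_prod, Multiset.map_map, Multiset.map_map]
    congr 1
    refine Multiset.map_congr rfl fun l _ => ?_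
    simp only [Function.comp_apply, taylorAlgHom_apply, map_sub, taylor_X, taylor_C, C_add, C_neg]
    ring

lemma AnalyticallySplits.of_scaleRoots {f g : ℂ → ℂ[X]} {s : ℂ → ℂ} (hs : AnalyticAt ℂ s 0)
    (h : AnalyticallySplits g) (hf : ∀ᶠ z in 𝓝 0, f z = (g z).scaleRoots (s z)) :
    AnalyticallySplits f := by
  obtain ⟨L, hL, hgL⟩ := h
  refine ⟨L.map fun l z => l z * s z, ?_, ?_⟩
  · intro l hl
    obtain ⟨l', hl', rfl⟩ := Multiset.mem_map.1 hl
    exact (hL l' hl').mul hs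
  · filter_upwards [hf, hgL] with z h1 h2
    rw [h1, h2, Multiset.map_map]
    clear hL hgL h2
    induction L using Multiset.induction_on with
    | empty => simp
    | cons l L ih =>
      rw [Multiset.map_cons, Multiset.prod_cons, Multiset.map_cons, Multiset.prod_cons,
        mul_scaleRoots_of_noZeroDivisors, ih]
      congr 1
      ext k
      rw [coeff_scaleRoots, natDegree_X_sub_C]
      rcases k with _ | _ | k <;> simp [coeff_X, coeff_C]

lemma AnalyticFamily.taylor_comp {f : ℂ → ℂ[X]} (hf : AnalyticFamily f) {c : ℂ → ℂ}
    (hc : AnalyticAt ℂ c 0) {n : ℕ} (hn : ∀ᶠ z in 𝓝 0, (f z).natDegree = n) :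
    AnalyticFamily fun z => taylor (c z) (f z) := by
  intro k
  have h1 : AnalyticAt ℂ (fun z => ∑ i ∈ Finset.range (n + 1),
      ((((i + k).choose k : ℕ) : ℂ) * (f z).coeff (i + k)) * c z ^ i) 0 := by
    refine Finset.analyticAt_fun_sum _ fun i _ => ?_
    exact (analyticAt_const.mul (hf _)).mul (hc.pow i)
  refine h1.congr ?_
  filter_upwards [hn] with z hz
  rw [taylor_coeff, eval_eq_sum_range' (n := n + 1)]
  · simp only [hasseDeriv_coeff]
  · exact Nat.lt_succ_of_le ((natDegree_hasseDeriv_le _ _).trans (by omega))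

/-- Split off the full power of one root. It is a proper factor, because a centered pure power `(X -
c) ^ (m + 2)` has `c = 0`, and then its coefficient at `m` vanishes. -/
lemma coprime_factorization_of_centered {p : ℂ[X]} (hp : p.Monic) {m : ℕ}
    (hd : p.natDegree = m + 2) (h1 : p.coeff (m + 1) = 0) (h2 : p.coeff m ≠ 0) :
    ∃ g h : ℂ[X], g.Monic ∧ h.Monic ∧ IsCoprime g h ∧ p = g * h ∧
      g.natDegree < m + 2 ∧ h.natDegree < m + 2 := by
  obtain ⟨c, hc⟩ := IsAlgClosed.exists_root p (degree_ne_of_natDegree_ne (n := 0) (by omega))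
  obtain ⟨q, hq, hnd⟩ := exists_eq_pow_rootMultiplicity_mul_and_not_dvd p hp.ne_zero c
  set k := rootMultiplicity c p with hk
  have hk0 : 0 < k := (rootMultiplicity_pos hp.ne_zero).2 hc
  have hgm : ((X - C c) ^ k).Monic := (monic_X_sub_C c).pow k
  have hqm : q.Monic := hgm.of_mul_monic_left (hq ▸ hp)
  have hdeg : k + q.natDegree = m + 2 := by
    rw [← hd]
    conv_rhs => rw [hq, hgm.natDegree_mul hqm]
    simp
  refine ⟨(X - C c) ^ k, q, hgm, hqm,
    (((irreducible_X_sub_C c).coprime_iff_not_dvd).2 hnd).pow_left, hq, ?_, by omega⟩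
  rw [natDegree_pow, natDegree_X_sub_C, mul_one]
  by_contra hlt
  have hk2 : k = m + 2 := by omega
  have hq1 : q = 1 := eq_one_of_monic_natDegree_zero hqm (by omega)
  rw [hq1, mul_one, hk2] at hq
  have hn : p.nextCoeff = 0 := by
    rw [nextCoeff_of_natDegree_pos (by omega), hd]
    exact h1
  rw [hq, (monic_X_sub_C c).nextCoeff_pow, nextCoeff_X_sub_C] at hn
  have hc0 : c = 0 := by
    have : (m : ℂ) + 2 ≠ 0 := by exact_mod_cast Nat.succ_ne_zero (m + 1)
    simpa [this] using hn
  apply h2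
  rw [hq, hc0]
  simp [coeff_X_pow]

/-- Rescaling a centered real-rooted analytic family: either it is `X ^ (m + 2)`, or a suitable
rescaling of the variable makes it a family which is not a pure power at `0`. -/
lemma AnalyticFamily.exists_rescaling {f : ℂ → ℂ[X]} (hf : AnalyticFamily f) {m : ℕ}
    (hfm : ∀ᶠ z in 𝓝 0, (f z).Monic ∧ (f z).natDegree = m + 2)
    (hc : ∀ᶠ z in 𝓝 0, (f z).coeff (m + 1) = 0) (hr : RealRooted f) :
    (∀ᶠ z in 𝓝 0, f z = X ^ (m + 2)) ∨
    ∃ (r : ℕ) (g : ℂ → ℂ[X]), AnalyticFamily g ∧ (∀ z, (g z).Monic ∧ (g z).natDegree = m + 2) ∧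
      (g 0).coeff (m + 1) = 0 ∧ (g 0).coeff m ≠ 0 ∧ RealRooted g ∧
      ∀ᶠ z in 𝓝 0, f z = (g z).scaleRoots (z ^ r) := by
  have hreal := tendsto_ofReal_punctured.mono_right nhdsWithin_le_nhds
  -- The bound `B` on the roots is left free: `B = 0` serves when the coefficient at `m` vanishes
  -- identically, and `B = D * |x| ^ r` when it has order `2 * r`.
  have hbd : ∀ᶠ x : ℝ in 𝓝[≠] 0, (((f x).coeff m).re ≤ 0 ∧ ((f x).coeff m).im = 0) ∧
      ∀ i, ∀ B : ℝ, 2 * ‖(f x).coeff m‖ ≤ B ^ 2 → 0 ≤ B →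
        ‖(f x).coeff i‖ ≤ B ^ (m + 2 - i) * ((m + 2).choose i) := by
    filter_upwards [hreal.eventually hfm, hreal.eventually hc, hr] with x h1 h2 h3
    have h4 := h1.1.roots_bound_of_real h1.2 h2 h3
    refine ⟨h4.1, fun i B hB hB0 => ?_⟩
    have := coeff_le_of_roots_le (p := f x) (f := RingHom.id ℂ) (B := B) i h1.1
      (IsAlgClosed.splits _) (by
        intro c hcr
        rw [Polynomial.map_id] at hcr
        exact abs_le_of_sq_le_sq' ((h4.2 c hcr).trans hB) hB0 |>.2)
    rwa [Polynomial.map_id, h1.2] at this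
  by_cases hz : ∀ᶠ z in 𝓝 0, (f z).coeff m = 0
  · left
    have h0 : ∀ i ∈ Finset.range (m + 2), ∀ᶠ z in 𝓝 0, (f z).coeff i = 0 := by
      intro i hi
      refine (hf i).eventually_zero_of_real ?_
      filter_upwards [hbd, hreal.eventually hz] with x hx hx0
      have := hx.2 i 0 (by simp [hx0]) le_rfl
      rw [Finset.mem_range] at hi
      rw [zero_pow (by omega), zero_mul] at this
      exact norm_le_zero_iff.1 this
    filter_upwards [hfm, (Filter.eventually_all_finset _).2 h0] with z h1 h2
    rw [← X_pow_add_ofCoeffs h1.1 h1.2]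
    have : (fun i : Fin (m + 2) => (f z).coeff i) = 0 := by
      ext i
      exact h2 i (Finset.mem_range.2 i.2)
    rw [this, map_zero, add_zero]
  · right
    obtain ⟨r, u, hu, hu0, hau⟩ := (hf m).exists_even_order_of_nonpos hz
      (hbd.mono fun x hx => hx.1)
    have hub : ∀ᶠ x : ℝ in 𝓝[≠] 0, ‖u x‖ ≤ ‖u 0‖ + 1 := by
      have : ∀ᶠ z in 𝓝 (0 : ℂ), ‖u z‖ < ‖u 0‖ + 1 :=
        hu.continuousAt.norm.eventually_lt continuousAt_const (by simp)
      exact (hreal.eventually this).mono fun x hx => hx.le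
    set D := Real.sqrt (2 * (‖u 0‖ + 1)) with hD
    have hD0 : 0 ≤ D := Real.sqrt_nonneg _
    have hDs : D ^ 2 = 2 * (‖u 0‖ + 1) := Real.sq_sqrt (by positivity)
    have hb : ∀ i : Fin (m + 2), ∃ b : ℂ → ℂ, AnalyticAt ℂ b 0 ∧
        ∀ᶠ z in 𝓝 0, (f z).coeff i = z ^ (r * (m + 2 - i)) * b z := by
      intro i
      refine (hf i).exists_eq_pow_mul_of_bound
        (K := D ^ (m + 2 - (i : ℕ)) * ((m + 2).choose i)) ?_
      filter_upwards [hbd, hub, hreal.eventually hau] with x h1 h2 h3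
      refine (h1.2 i (D * |x| ^ r) ?_ (by positivity)).trans (le_of_eq ?_)
      · rw [h3, norm_mul, norm_pow, Complex.norm_real, Real.norm_eq_abs, mul_pow, hDs, ← pow_mul,
          mul_comm r 2]
        nlinarith [mul_le_mul_of_nonneg_left h2 (show 0 ≤ |x| ^ (2 * r) by positivity)]
      · rw [mul_pow, ← pow_mul]
        ring
    choose b hba hbf using hb
    set g : ℂ → ℂ[X] := fun z => X ^ (m + 2) + ofCoeffs (m + 2) (fun i => b i z) with hg
    have hgm : ∀ z, (g z).Monic ∧ (g z).natDegree = m + 2 := fun z =>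
      ⟨monic_X_pow_add_ofCoeffs _, natDegree_X_pow_add_ofCoeffs _⟩
    have hga : AnalyticFamily g :=
      analyticFamily_X_pow_add_ofCoeffs (analyticAt_pi_iff.2 hba)
    have hgc : ∀ z, ∀ i : Fin (m + 2), (g z).coeff i = b i z := by
      intro z i
      have := i.2
      simp [hg, ofCoeffs_coeff, coeff_X_pow, this.ne]
    have hfg : ∀ᶠ z in 𝓝 0, f z = (g z).scaleRoots (z ^ r) := by
      filter_upwards [hfm, Filter.eventually_all.2 hbf] with z h1 h2
      ext k
      rw [coeff_scaleRoots, (hgm z).2]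
      rcases lt_trichotomy k (m + 2) with h | h | h
      · have h3 := h2 ⟨k, h⟩
        have h4 := hgc z ⟨k, h⟩
        simp only at h3 h4
        rw [h3, h4, pow_mul]
        ring
      · subst h
        have h3 := h1.1.coeff_natDegree
        have h4 := (hgm z).1.coeff_natDegree
        rw [h1.2] at h3
        rw [(hgm z).2] at h4
        rw [h3, h4]
        simp
      · rw [coeff_eq_zero_of_natDegree_lt (h1.2 ▸ h),
          coeff_eq_zero_of_natDegree_lt ((hgm z).2 ▸ h), zero_mul]
    -- The rescaling can be undone only for `z ≠ 0`; coefficients of `g 0` are recovered by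
    -- continuity.
    have hlim : ∀ i, ∀ v : ℂ → ℂ, AnalyticAt ℂ v 0 → ∀ s : ℕ,
        (∀ᶠ z in 𝓝 0, z ^ s * (g z).coeff i = z ^ s * v z) → (g 0).coeff i = v 0 := by
      intro i v hv s h
      have h1 : Tendsto (fun z => (g z).coeff i) (𝓝[≠] 0) (𝓝 ((g 0).coeff i)) :=
        (hga i).continuousAt.tendsto.mono_left nhdsWithin_le_nhds
      have h2 : Tendsto v (𝓝[≠] 0) (𝓝 (v 0)) :=
        hv.continuousAt.tendsto.mono_left nhdsWithin_le_nhds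
      refine tendsto_nhds_unique h1 (h2.congr' ?_)
      filter_upwards [nhdsWithin_le_nhds h, self_mem_nhdsWithin] with z hz hz0
      exact (mul_left_cancel₀ (pow_ne_zero _ hz0) hz).symm
    refine ⟨r, g, hga, hgm, ?_, ?_, ?_, hfg⟩
    · refine hlim (m + 1) 0 analyticAt_const r ?_
      filter_upwards [hfg, hc] with z h1 h2
      rw [h1, coeff_scaleRoots, (hgm z).2, show m + 2 - (m + 1) = 1 by omega, pow_one] at h2
      rw [mul_comm, h2]
      simp
    · rw [hlim m u hu (2 * r) ?_]
      · exact hu0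
      filter_upwards [hfg, hau] with z h1 h2
      rw [h1, coeff_scaleRoots, (hgm z).2, show m + 2 - m = 2 by omega, ← pow_mul] at h2
      rw [← h2, mul_comm 2 r]
      ring
    · filter_upwards [hr, hreal.eventually hfg, self_mem_nhdsWithin] with x h1 h2 hx0 c hcr
      have hx : x ^ r ≠ 0 := pow_ne_zero _ hx0
      have h3 : ((x : ℂ) ^ r * c) ∈ (f x).roots := by
        rw [h2, mem_roots (scaleRoots_ne_zero (hgm x).1.ne_zero _), IsRoot, eval]
        have := scaleRoots_eval₂_mul (p := g x) (RingHom.id ℂ) c ((x : ℂ) ^ r)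
        rw [RingHom.id_apply] at this
        rw [this]
        have h4 : eval₂ (RingHom.id ℂ) c (g x) = 0 := isRoot_of_mem_roots hcr
        rw [h4, mul_zero]
      have h4 := h1 _ h3
      rw [← Complex.ofReal_pow, Complex.im_ofReal_mul] at h4
      exact (mul_eq_zero.1 h4).resolve_left hx

/-- **Rellich's theorem** for polynomials: the roots of an analytic family of monic polynomials
which is real-rooted at real parameters are analytic functions of the parameter. -/
theorem AnalyticFamily.analyticallySplits (n : ℕ) : ∀ f : ℂ → ℂ[X], AnalyticFamily f →
    (∀ᶠ z in 𝓝 0, (f z).Monic ∧ (f z).natDegree = n) → RealRooted f → AnalyticallySplits f := by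
  induction n using Nat.strong_induction_on with
  | _ n ih =>
  intro f hf hfm hr
  have hreal := tendsto_ofReal_punctured.mono_right nhdsWithin_le_nhds
  have hlow : ∀ f₁ f₂ f₃ : ℂ → ℂ[X], (∀ᶠ z in 𝓝 0, (f₁ z).Monic) → RealRooted f₁ →
      (∀ᶠ z in 𝓝 0, f₁ z = f₂ z * f₃ z) → RealRooted f₂ := by
    intro f₁ f₂ f₃ h1 h2 h3
    filter_upwards [hreal.eventually h1, h2, hreal.eventually h3] with x k1 k2 k3 c hc
    exact k2 c (Multiset.mem_of_le
      (roots.le_of_dvd k1.ne_zero (Dvd.intro _ k3.symm)) hc)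
  obtain rfl | rfl | ⟨m, rfl⟩ : n = 0 ∨ n = 1 ∨ ∃ m, n = m + 2 := by
    rcases n with _ | _ | m
    · simp
    · simp
    · exact Or.inr (Or.inr ⟨m, rfl⟩)
  · refine ⟨0, by simp, ?_⟩
    filter_upwards [hfm] with z hz
    simpa using eq_one_of_monic_natDegree_zero hz.1 hz.2
  · refine ⟨{fun z => -(f z).coeff 0}, fun l hl => Multiset.mem_singleton.1 hl ▸ (hf 0).neg, ?_⟩
    filter_upwards [hfm] with z hz
    rw [Multiset.map_singleton, Multiset.prod_singleton]
    conv_lhs => rw [hz.1.eq_X_add_C hz.2]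
    simp
  -- This is the mean of the roots; translating by it kills the coefficient at `m + 1`.
  · have hc : AnalyticAt ℂ (fun z => -(f z).coeff (m + 1) / (m + 2)) 0 :=
      (hf (m + 1)).neg.div_const
    refine AnalyticallySplits.of_taylor hc ?_
    set c : ℂ → ℂ := fun z => -(f z).coeff (m + 1) / (m + 2) with hcdef
    have hta := hf.taylor_comp hc (hfm.mono fun z hz => hz.2)
    have htm : ∀ᶠ z in 𝓝 0, (taylor (c z) (f z)).Monic ∧
        (taylor (c z) (f z)).natDegree = m + 2 := by
      filter_upwards [hfm] with z hz
      exact ⟨(leadingCoeff_taylor _ _).trans hz.1, (natDegree_taylor _ _).trans hz.2⟩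
    have hm0 : (m : ℂ) + 2 ≠ 0 := by exact_mod_cast Nat.succ_ne_zero (m + 1)
    have htc : ∀ᶠ z in 𝓝 0, (taylor (c z) (f z)).coeff (m + 1) = 0 := by
      filter_upwards [hfm] with z hz
      have h1 := hz.1.coeff_natDegree
      rw [hz.2] at h1
      rw [taylor_coeff, eval_eq_sum_range' (n := 2)]
      · simp only [hasseDeriv_coeff, Finset.sum_range_succ, Finset.sum_range_zero]
        rw [show 1 + (m + 1) = m + 2 by omega, h1, show m + 2 = (m + 1) + 1 by omega,
          Nat.choose_succ_self_right]
        simp only [hcdef]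
        push_cast
        simp
        field_simp
        ring
      · refine lt_of_le_of_lt (natDegree_hasseDeriv_le _ _) ?_
        omega
    have htr : RealRooted fun z => taylor (c z) (f z) := by
      filter_upwards [hreal.eventually hfm, hr] with x h1 h2 s hs
      have hs' : s + c x ∈ (f x).roots := by
        rw [mem_roots h1.1.ne_zero, IsRoot, ← taylor_eval]
        exact isRoot_of_mem_roots hs
      -- The shift is a mean of real roots, so it keeps the roots real.
      have hcr : (c x).im = 0 := by
        have h3 := IsAlgClosed.splits (f x)
        have h4 : (f x).coeff (m + 1) = -(f x).roots.sum := by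
          have := h3.nextCoeff_eq_neg_sum_roots_of_monic h1.1
          rwa [nextCoeff_of_natDegree_pos (by omega), h1.2] at this
        have h5 : ((f x).roots.sum).im = 0 := by
          have : ∀ t : Multiset ℂ, (∀ y ∈ t, y.im = 0) → t.sum.im = 0 := by
            intro t
            induction t using Multiset.induction_on with
            | empty => simp
            | cons a t iht => simp; intro ha ht; rw [ha, iht ht, add_zero]
          exact this _ h2
        have h6 : c x = (f x).roots.sum * (((m : ℝ) + 2)⁻¹ : ℝ) := by
          simp only [hcdef, h4]; push_cast; rw [neg_neg, div_eq_mul_inv]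
        rw [h6, Complex.im_mul_ofReal, h5, zero_mul]
      have := h2 _ hs'
      rwa [Complex.add_im, hcr, add_zero] at this
    rcases hta.exists_rescaling htm htc htr with hpow | ⟨r, g, hga, hgm, hg1, hg2, hgr, hfg⟩
    · refine ⟨Multiset.replicate (m + 2) fun _ => 0, ?_, ?_⟩
      · intro l hl
        rw [Multiset.eq_of_mem_replicate hl]
        exact analyticAt_const
      · filter_upwards [hpow] with z hz
        rw [hz, Multiset.map_replicate, Multiset.prod_replicate]
        simp
    · refine AnalyticallySplits.of_scaleRoots (s := fun z => z ^ r) (by fun_prop) ?_ hfg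
      -- After rescaling, `g 0` has two coprime proper factors; they extend to analytic families of
      -- smaller degree, to which the induction hypothesis applies.
      obtain ⟨p, q, hp, hq, hpq, h0, hpd, hqd⟩ :=
        coprime_factorization_of_centered (hgm 0).1 (hgm 0).2 hg1 hg2
      have hdeg : p.natDegree + q.natDegree = m + 2 := by
        rw [← hp.natDegree_mul hq, ← h0, (hgm 0).2]
      obtain ⟨g₁, g₂, ha1, ha2, hm1, hm2, hg12⟩ := hga.exists_factorization hp hq hpq h0
        (Filter.Eventually.of_forall fun z => by rw [hdeg]; exact hgm z)
      have hgm' : ∀ᶠ z in 𝓝 0, (g z).Monic := Filter.Eventually.of_forall fun z => (hgm z).1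
      refine AnalyticallySplits.mul
        (ih _ hpd g₁ ha1 (Filter.Eventually.of_forall hm1) (hlow g g₁ g₂ hgm' hgr hg12))
        (ih _ hqd g₂ ha2 (Filter.Eventually.of_forall hm2) (hlow g g₂ g₁ hgm' hgr ?_)) hg12
      filter_upwards [hg12] with z hz
      rw [hz, mul_comm]

end AnalyticRoots

/-! ### Rellich's theorem for matrix families -/

section AnalyticEigenbasis
open Polynomial

lemma AnalyticFamily.mul {f g : ℂ → ℂ[X]} (hf : AnalyticFamily f) (hg : AnalyticFamily g) :
    AnalyticFamily fun z => f z * g z := by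
  intro k
  simp only [coeff_mul]
  exact Finset.analyticAt_fun_sum _ fun i _ => (hf _).mul (hg _)

lemma AnalyticFamily.const (p : ℂ[X]) : AnalyticFamily fun _ => p := fun _ => analyticAt_const

lemma AnalyticFamily.X_sub_C {l : ℂ → ℂ} (hl : AnalyticAt ℂ l 0) :
    AnalyticFamily fun z => X - C (l z) := by
  intro k
  simp only [coeff_sub, coeff_C]
  split_ifs
  · exact analyticAt_const.sub hl
  · exact analyticAt_const.sub analyticAt_const

lemma AnalyticFamily.prod {ι : Type*} (s : Finset ι) {f : ι → ℂ → ℂ[X]}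
    (hf : ∀ i ∈ s, AnalyticFamily (f i)) : AnalyticFamily fun z => ∏ i ∈ s, f i z := by
  classical
  induction s using Finset.induction_on with
  | empty => simpa using AnalyticFamily.const 1
  | insert a s ha ih =>
    simp only [Finset.prod_insert ha]
    exact (hf a (by simp)).mul (ih fun i hi => hf i (by simp [hi]))

lemma AnalyticFamily.sum {ι : Type*} (s : Finset ι) {f : ι → ℂ → ℂ[X]}
    (hf : ∀ i ∈ s, AnalyticFamily (f i)) : AnalyticFamily fun z => ∑ i ∈ s, f i z := by
  intro k
  simp only [finsetSum_coeff]
  exact Finset.analyticAt_fun_sum _ fun i hi => hf i hi k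

variable {ι : Type*} [Fintype ι]

lemma AnalyticFamily.charpoly [DecidableEq ι] {T : ℂ → Matrix ι ι ℂ}
    (hT : ∀ i j, AnalyticAt ℂ (fun z => T z i j) 0) :
    AnalyticFamily fun z => (T z).charpoly := by
  simp only [Matrix.charpoly, Matrix.det_apply', Matrix.charmatrix_apply]
  refine AnalyticFamily.sum _ fun σ _ => (AnalyticFamily.const _).mul ?_
  refine AnalyticFamily.prod _ fun i _ k => ?_
  simp only [coeff_sub, coeff_C]
  split_ifs
  · exact analyticAt_const.sub (hT _ _)
  · exact analyticAt_const.sub analyticAt_const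

lemma analyticAt_matrix_mul {M M' : ℂ → Matrix ι ι ℂ}
    (hM : ∀ i j, AnalyticAt ℂ (fun z => M z i j) 0)
    (hM' : ∀ i j, AnalyticAt ℂ (fun z => M' z i j) 0) (i j : ι) :
    AnalyticAt ℂ (fun z => (M z * M' z) i j) 0 := by
  simp only [Matrix.mul_apply]
  exact Finset.analyticAt_fun_sum _ fun k _ => (hM _ _).mul (hM' _ _)

lemma AnalyticFamily.aeval [DecidableEq ι] {T : ℂ → Matrix ι ι ℂ} (hT : ∀ i j, AnalyticAt ℂ (fun z => T z i j) 0)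
    {f : ℂ → ℂ[X]} (hf : AnalyticFamily f) {n : ℕ} (hn : ∀ z, (f z).natDegree ≤ n) (i j : ι) :
    AnalyticAt ℂ (fun z => (Polynomial.aeval (T z) (f z)) i j) 0 := by
  have hpow : ∀ k : ℕ, ∀ i j, AnalyticAt ℂ (fun z => (T z ^ k) i j) 0 := by
    intro k
    induction k with
    | zero => intro i j; simp only [pow_zero]; exact analyticAt_const
    | succ k ih => simp only [pow_succ]; exact analyticAt_matrix_mul ih hT
  have h : ∀ z, (Polynomial.aeval (T z) (f z)) i j =
      ∑ k ∈ Finset.range (n + 1), (f z).coeff k * (T z ^ k) i j := by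
    intro z
    rw [aeval_eq_sum_range' (Nat.lt_succ_of_le (hn z)), Matrix.sum_apply]
    simp [Matrix.smul_apply]
  simp only [h]
  exact Finset.analyticAt_fun_sum _ fun k _ => (hf _).mul (hpow _ _ _)

/-- Diagonalizability makes vanishing on the eigenvalues enough, whatever their multiplicities. -/
lemma Matrix.IsHermitian.aeval_eq_zero [DecidableEq ι] {A : Matrix ι ι ℂ} (hA : A.IsHermitian) {p : ℂ[X]}
    (hp : ∀ x ∈ A.charpoly.roots, p.eval x = 0) : aeval A p = 0 := by
  have hd : aeval (Matrix.diagonal (RCLike.ofReal ∘ hA.eigenvalues : ι → ℂ)) p = 0 := by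
    have h1 : Matrix.diagonal (RCLike.ofReal ∘ hA.eigenvalues : ι → ℂ) =
      Matrix.diagonalAlgHom ℂ (RCLike.ofReal ∘ hA.eigenvalues : ι → ℂ) := rfl
    rw [h1, aeval_algHom_apply]
    have h2 : aeval (RCLike.ofReal ∘ hA.eigenvalues : ι → ℂ) p = 0 := by
      ext i
      have h3 := aeval_algHom_apply (Pi.evalAlgHom ℂ (fun _ : ι => ℂ) i)
        (RCLike.ofReal ∘ hA.eigenvalues : ι → ℂ) p
      rw [Pi.evalAlgHom_apply, Pi.evalAlgHom_apply] at h3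
      rw [← h3, Pi.zero_apply, coe_aeval_eq_eval]
      apply hp
      rw [hA.roots_charpoly_eq_eigenvalues]
      exact Multiset.mem_map_of_mem _ (Finset.mem_univ i)
    rw [h2, map_zero]
  have hs := hA.spectral_theorem
  set U := (Unitary.conjStarAlgAut ℂ (Matrix ι ι ℂ)) hA.eigenvectorUnitary
  have h4 := aeval_algHom_apply (U : Matrix ι ι ℂ →ₐ[ℂ] Matrix ι ι ℂ)
    (Matrix.diagonal (RCLike.ofReal ∘ hA.eigenvalues)) p
  rw [hd, map_zero] at h4
  rw [hs]
  exact h4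

/-- Two analytic germs either coincide or differ on a punctured neighbourhood, so one representative
per germ can be kept. -/
lemma exists_distinct_germs (L : Multiset (ℂ → ℂ)) (hL : ∀ l ∈ L, AnalyticAt ℂ l 0) :
    ∃ S : Finset (ℂ → ℂ), (∀ s ∈ S, AnalyticAt ℂ s 0) ∧
      (∀ l ∈ L, ∃ s ∈ S, ∀ᶠ z in 𝓝 0, l z = s z) ∧
      ∀ s ∈ S, ∀ t ∈ S, s ≠ t → ∀ᶠ z in 𝓝[≠] 0, s z ≠ t z := by
  classical
  induction L using Multiset.induction_on with
  | empty => exact ⟨∅, by simp, by simp, by simp⟩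
  | cons l L ih =>
    obtain ⟨S, h1, h2, h3⟩ := ih fun l hl => hL l (Multiset.mem_cons_of_mem hl)
    have hl := hL l (Multiset.mem_cons_self l L)
    by_cases h : ∃ s ∈ S, ∀ᶠ z in 𝓝 0, l z = s z
    · refine ⟨S, h1, fun l' hl' => ?_, h3⟩
      rcases Multiset.mem_cons.1 hl' with rfl | hl'
      · exact h
      · exact h2 l' hl'
    · have hne : ∀ s ∈ S, ∀ᶠ z in 𝓝[≠] 0, l z ≠ s z := by
        intro s hs
        have := (hl.fun_sub (h1 s hs)).eventually_eq_zero_or_eventually_ne_zero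
        simp only [sub_eq_zero, sub_ne_zero] at this
        exact this.resolve_left fun h' => h ⟨s, hs, h'⟩
      refine ⟨insert l S, ?_, ?_, ?_⟩
      · intro s hs
        rcases Finset.mem_insert.1 hs with rfl | hs
        · exact hl
        · exact h1 s hs
      · intro l' hl'
        rcases Multiset.mem_cons.1 hl' with rfl | hl'
        · exact ⟨_, Finset.mem_insert_self _ _, Filter.Eventually.of_forall fun _ => rfl⟩
        · obtain ⟨s, hs, hs'⟩ := h2 l' hl'
          exact ⟨s, Finset.mem_insert_of_mem hs, hs'⟩
      · intro s hs t ht hst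
        rcases Finset.mem_insert.1 hs with rfl | hs' <;> rcases Finset.mem_insert.1 ht with rfl | ht'
        · exact absurd rfl hst
        · exact hne t ht'
        · exact (hne s hs').mono fun z hz => hz.symm
        · exact h3 s hs' t ht' hst

/-- If the distinct numbers `v s`, `s ∈ S`, are the roots of a polynomial annihilating `A`, then
the columns of the partial products span the whole space. -/
lemma span_columns_eq_top [DecidableEq ι] {σ : Type*} [DecidableEq σ] (S : Finset σ) (v : σ → ℂ)
    (hv : Set.InjOn v S) (A : Matrix ι ι ℂ) (hA : aeval A (∏ s ∈ S, (X - C (v s))) = 0) :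
    Submodule.span ℂ (Set.range fun x : S × ι => fun i =>
      (aeval A (∏ t ∈ S.erase x.1, (X - C (v t)))) i x.2) = ⊤ := by
  rw [eq_top_iff]
  intro x _
  rcases S.eq_empty_or_nonempty with rfl | hS
  · have h1 : (1 : Matrix ι ι ℂ) = 0 := by simpa using hA
    have : x = 0 := by rw [← Matrix.one_mulVec x, h1, Matrix.zero_mulVec]
    rw [this]
    exact Submodule.zero_mem _
  -- The Lagrange basis polynomials sum to `1`, so every vector is a sum of images of the partial
  -- products.
  have h1 : aeval A (∑ s ∈ S, Lagrange.basis S v s) = 1 := by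
    rw [Lagrange.sum_basis hv hS, map_one]
  rw [← Matrix.one_mulVec x, ← h1, map_sum, Matrix.sum_mulVec]
  refine Submodule.sum_mem _ fun s hs => ?_
  have h2 : Lagrange.basis S v s = C (∏ t ∈ S.erase s, (v s - v t)⁻¹) *
      ∏ t ∈ S.erase s, (X - C (v t)) := by
    simp only [Lagrange.basis, Lagrange.basisDivisor, Finset.prod_mul_distrib, map_prod]
  rw [h2, map_mul, aeval_C, ← Algebra.smul_def, Matrix.smul_mulVec]
  refine Submodule.smul_mem _ _ ?_
  set Q := aeval A (∏ t ∈ S.erase s, (X - C (v t))) with hQ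
  have h3 : Q *ᵥ x = ∑ j, x j • fun i => Q i j := by
    ext i
    simp [Matrix.mulVec, dotProduct, Finset.sum_apply, mul_comm]
  rw [h3]
  exact Submodule.sum_mem _ fun j _ => Submodule.smul_mem _ _
    (Submodule.subset_span ⟨(⟨s, hs⟩, j), rfl⟩)

lemma exists_linearIndependent_comp_of_span_eq_top {κ : Type*} (u : κ → ι → ℂ)
    (hu : Submodule.span ℂ (Set.range u) = ⊤) : ∃ c : ι → κ, LinearIndependent ℂ (u ∘ c) := by
  obtain ⟨κ', a, -, hspan, hli⟩ := exists_linearIndependent' ℂ u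
  have hb := Module.Basis.mk hli (by rw [hspan, hu])
  let e := (Pi.basisFun ℂ ι).indexEquiv hb
  exact ⟨a ∘ e, hli.comp e e.injective⟩

/-- **Rellich's theorem**: an analytic matrix family which is Hermitian at real parameters has
analytic eigenvalues, with analytic eigenvectors that form a basis outside of the centre. -/
theorem exists_analytic_eigenbasis [DecidableEq ι] {T : ℂ → Matrix ι ι ℂ}
    (hT : ∀ i j, AnalyticAt ℂ (fun z => T z i j) 0) (hH : ∀ x : ℝ, (T x).IsHermitian) :
    ∃ (μ : ι → ℂ → ℂ) (w : ι → ℂ → ι → ℂ), (∀ i, AnalyticAt ℂ (μ i) 0) ∧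
      (∀ i, AnalyticAt ℂ (w i) 0) ∧ (∀ᶠ z in 𝓝 0, ∀ i, T z *ᵥ w i z = μ i z • w i z) ∧
      ∀ᶠ z in 𝓝[≠] 0, LinearIndependent ℂ fun i => w i z := by
  classical
  have hreal := tendsto_ofReal_punctured.mono_right nhdsWithin_le_nhds
  obtain ⟨L, hL, hLc⟩ := AnalyticFamily.analyticallySplits (Fintype.card ι)
    (fun z => (T z).charpoly) (AnalyticFamily.charpoly hT)
    (Filter.Eventually.of_forall fun z =>
      ⟨Matrix.charpoly_monic _, Matrix.charpoly_natDegree_eq_dim _⟩)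
    (Filter.Eventually.of_forall fun x c hc => by
      rw [(hH x).roots_charpoly_eq_eigenvalues] at hc
      obtain ⟨i, -, rfl⟩ := Multiset.mem_map.1 hc
      simp)
  obtain ⟨S, hS, hLS, hSd⟩ := exists_distinct_germs L hL
  set p : ℂ → ℂ[X] := fun z => ∏ s ∈ S, (X - C (s z)) with hp
  set q : S → ℂ → ℂ[X] := fun s z => ∏ t ∈ S.erase s, (X - C (t z)) with hq
  have hdeg : ∀ (S' : Finset (ℂ → ℂ)) (z : ℂ), (∏ s ∈ S', (X - C (s z))).natDegree ≤ S'.card := by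
    intro S' z
    rw [natDegree_prod_of_monic _ _ fun s _ => monic_X_sub_C _]
    simp
  have hpa : AnalyticFamily p := AnalyticFamily.prod _ fun s hs => AnalyticFamily.X_sub_C (hS s hs)
  have hqa : ∀ s, AnalyticFamily (q s) := fun s =>
    AnalyticFamily.prod _ fun t ht => AnalyticFamily.X_sub_C (hS t (Finset.mem_of_mem_erase ht))
  have hQa : ∀ s i j, AnalyticAt ℂ (fun z => (aeval (T z) (q s z)) i j) 0 := fun s =>
    (hqa s).aeval hT (hdeg _)
  -- The product over distinct germs annihilates `T x` at real `x`, where `T x` is Hermitian; the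
  -- identity theorem extends this to complex `z`.
  have hann : ∀ᶠ z in 𝓝 0, aeval (T z) (p z) = 0 := by
    have hLS' : ∀ᶠ z in 𝓝 0, ∀ l ∈ L.toFinset, ∃ s ∈ S, l z = s z := by
      refine (Filter.eventually_all_finset _).2 fun l hl => ?_
      obtain ⟨s, hs, h⟩ := hLS l (Multiset.mem_toFinset.1 hl)
      exact h.mono fun z hz => ⟨s, hs, hz⟩
    have : ∀ i j, ∀ᶠ z in 𝓝 0, (aeval (T z) (p z)) i j = 0 := by
      intro i j
      refine (hpa.aeval hT (hdeg _) i j).eventually_zero_of_real ?_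
      filter_upwards [hreal.eventually hLc, hreal.eventually hLS'] with x h1 h2
      rw [(hH x).aeval_eq_zero, Matrix.zero_apply]
      intro c hc
      rw [h1, mem_roots (by rw [← h1]; exact (Matrix.charpoly_monic _).ne_zero), IsRoot,
        eval_multiset_prod, Multiset.prod_eq_zero_iff, Multiset.map_map] at hc
      obtain ⟨l, hl, hl0⟩ := Multiset.mem_map.1 hc
      obtain ⟨s, hs, hls⟩ := h2 l (Multiset.mem_toFinset.2 hl)
      rw [eval_prod]
      refine Finset.prod_eq_zero hs ?_
      simpa [hls] using hl0
    filter_upwards [Filter.eventually_all.2 fun i => Filter.eventually_all.2 (this i)] with z hz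
    ext i j
    exact hz i j
  set u : S × ι → ℂ → ι → ℂ := fun x z i => (aeval (T z) (q x.1 z)) i x.2 with hu
  have hua : ∀ x, AnalyticAt ℂ (u x) 0 := fun x => analyticAt_pi_iff.2 fun i => hQa _ _ _
  have heig : ∀ᶠ z in 𝓝 0, ∀ x : S × ι, T z *ᵥ u x z = (x.1 : ℂ → ℂ) z • u x z := by
    filter_upwards [hann] with z hz x
    have h1 : p z = (X - C ((x.1 : ℂ → ℂ) z)) * q x.1 z :=
      (Finset.mul_prod_erase S (fun s => X - C (s z)) x.1.2).symm
    rw [h1, map_mul, map_sub, aeval_X, aeval_C, sub_mul, sub_eq_zero, ← Algebra.smul_def] at hz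
    ext i
    exact congrFun (congrFun hz i) x.2
  have hspan : ∀ᶠ z in 𝓝[≠] 0, ∃ c : ι → S × ι, LinearIndependent ℂ fun i => u (c i) z := by
    have hdist : ∀ᶠ z in 𝓝[≠] (0 : ℂ), ∀ s ∈ S, ∀ t ∈ S, s ≠ t → s z ≠ t z := by
      refine (Filter.eventually_all_finset _).2 fun s hs =>
        (Filter.eventually_all_finset _).2 fun t ht => ?_
      by_cases hst : s = t
      · simp [hst]
      · filter_upwards [hSd s hs t ht hst] with z hz _ using hz
    filter_upwards [hdist, nhdsWithin_le_nhds hann] with z h1 h2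
    have hinj : Set.InjOn (fun s : ℂ → ℂ => s z) S := by
      intro s hs t ht hst
      by_contra hne
      exact h1 s hs t ht hne hst
    exact exists_linearIndependent_comp_of_span_eq_top (fun x => u x z)
      (span_columns_eq_top S (fun s => s z) hinj (T z) h2)
  -- The selection of columns must not depend on `z`. There are finitely many selections, each with
  -- an analytic determinant; were all of these identically zero near `0`, no selection could be
  -- independent at any nearby `z`.
  have hc : ∃ c : ι → S × ι, ∀ᶠ z in 𝓝[≠] 0, LinearIndependent ℂ fun i => u (c i) z := by
    have hli : ∀ (c : ι → S × ι) (z : ℂ), LinearIndependent ℂ (fun i => u (c i) z) ↔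
        (Matrix.of fun i => u (c i) z).det ≠ 0 := by
      intro c z
      rw [← isUnit_iff_ne_zero, ← Matrix.isUnit_iff_isUnit_det,
        ← Matrix.linearIndependent_rows_iff_isUnit]
      rfl
    have hda : ∀ c : ι → S × ι,
        AnalyticAt ℂ (fun z => (Matrix.of fun i => u (c i) z).det) 0 := by
      intro c
      simp only [Matrix.det_apply', Matrix.of_apply]
      refine Finset.analyticAt_fun_sum _ fun σ _ => analyticAt_const.mul ?_
      exact Finset.analyticAt_fun_prod _ fun i _ => analyticAt_pi_iff.1 (hua _) i
    by_contra hcon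
    rw [not_exists] at hcon
    have hz : ∀ c : ι → S × ι, ∀ᶠ z in 𝓝 0, (Matrix.of fun i => u (c i) z).det = 0 := by
      intro c
      refine (hda c).eventually_eq_zero_or_eventually_ne_zero.resolve_right fun h => ?_
      exact hcon c (h.mono fun z hz => (hli c z).2 hz)
    obtain ⟨z, ⟨c, hc1⟩, hc2⟩ :=
      (hspan.and (nhdsWithin_le_nhds (Filter.eventually_all.2 hz))).exists
    exact (hli c z).1 hc1 (hc2 c)
  obtain ⟨c, hc⟩ := hc
  refine ⟨fun i => (c i).1, fun i => u (c i), fun i => hS _ (c i).1.2, fun i => hua _, ?_, hc⟩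
  filter_upwards [heig] with z hz i using hz (c i)

/-- The characteristic polynomial of a matrix with a basis of eigenvectors. -/
lemma Matrix.charpoly_eq_prod_of_eigenbasis [DecidableEq ι] {κ : Type*} [Fintype κ]
    {A : Matrix ι ι ℂ} {w : κ → ι → ℂ} {ζ : κ → ℂ} (hw : LinearIndependent ℂ w)
    (hs : Submodule.span ℂ (Set.range w) = ⊤) (he : ∀ j, A *ᵥ w j = ζ j • w j) :
    A.charpoly = ∏ j, (X - C (ζ j)) := by
  classical
  let b := Module.Basis.mk hw hs.ge
  have h1 : LinearMap.toMatrix b b (Matrix.toLin' A) = Matrix.diagonal ζ := by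
    ext i j
    rw [LinearMap.toMatrix_apply, Matrix.toLin'_apply]
    have : b j = w j := Module.Basis.mk_apply _ _ _
    rw [this, he, ← this, map_smul, b.repr_self, Finsupp.smul_apply, Finsupp.single_apply,
      Matrix.diagonal_apply]
    by_cases hij : i = j
    · simp [hij]
    · simp [hij, Ne.symm hij]
  rw [← Matrix.charpoly_diagonal, ← h1, LinearMap.charpoly_toMatrix, Matrix.charpoly_toLin']

end AnalyticEigenbasis

/-! ### Spectra of the real matrices and the quadratic pencil -/

section RealMatrices
open Polynomial

lemma complexify_eq_map {m n : Type*} (M : Matrix m n ℝ) :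
    complexify M = M.map (algebraMap ℝ ℂ) := rfl

lemma complexify_mul {l m n : Type*} [Fintype m] (M : Matrix l m ℝ) (M' : Matrix m n ℝ) :
    complexify (M * M') = complexify M * complexify M' := by
  simp only [complexify_eq_map]
  exact Matrix.map_mul

lemma complexify_transpose {m n : Type*} (M : Matrix m n ℝ) :
    complexify Mᵀ = (complexify M)ᵀ := rfl

lemma complexify_conjTranspose {m n : Type*} (M : Matrix m n ℝ) :
    (complexify M)ᴴ = complexify Mᵀ := by
  ext i j
  simp [complexify]

lemma complexify_neg {m n : Type*} (M : Matrix m n ℝ) : complexify (-M) = -complexify M := by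
  ext i j
  simp [complexify]

lemma complexify_one {n : Type*} [DecidableEq n] :
    complexify (1 : Matrix n n ℝ) = 1 := by
  simp [complexify]

lemma det_complexify {n : Type*} [Fintype n] [DecidableEq n] (M : Matrix n n ℝ) :
    (complexify M).det = (M.det : ℂ) :=
  (RingHom.map_det (algebraMap ℝ ℂ) M).symm

lemma roots_prod_univ_X_sub_C {ι : Type*} [Fintype ι] (a : ι → ℂ) :
    (∏ i, (X - C (a i))).roots = Finset.univ.val.map a := by
  have := roots_multiset_prod_X_sub_C (Finset.univ.val.map a)
  rwa [Multiset.map_map] at this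

/-- The nonzero eigenvalues of a positive semidefinite matrix, in increasing order. -/
lemma Matrix.PosSemidef.exists_listsNonzeroEigenvalues {N : ℕ} {M : Matrix (Fin N) (Fin N) ℝ}
    (hM : M.PosSemidef) :
    ∃ b : Fin M.rank → ℝ, ListsNonzeroEigenvalues M b ∧ ∀ k, 0 < b k := by
  classical
  have hH := hM.isHermitian
  let e : {i // hH.eigenvalues i ≠ 0} ≃ Fin M.rank :=
    Fintype.equivFinOfCardEq hH.rank_eq_card_non_zero_eigs.symm
  set b₀ : Fin M.rank → ℝ := fun k => hH.eigenvalues (e.symm k) with hb₀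
  refine ⟨b₀ ∘ Tuple.sort b₀, ⟨Tuple.monotone_sort b₀, ?_⟩, fun k => ?_⟩
  · have hroots : (complexify M).charpoly.roots =
        Finset.univ.val.map fun i => (hH.eigenvalues i : ℂ) := by
      rw [complexify_eq_map, Matrix.charpoly_map, hH.charpoly_eq]
      simp only [Polynomial.map_prod, Polynomial.map_sub, map_X, map_C]
      exact roots_prod_univ_X_sub_C fun i => (hH.eigenvalues i : ℂ)
    have hperm : Finset.univ.val.map (fun k => (((b₀ ∘ Tuple.sort b₀) k : ℝ) : ℂ)) =
        Finset.univ.val.map fun x : {i // hH.eigenvalues i ≠ 0} => (hH.eigenvalues x : ℂ) := by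
      have := Multiset.map_univ_val_equiv ((Tuple.sort b₀).trans e.symm)
      rw [← this, Multiset.map_map]
      rfl
    rw [hperm, hroots, Multiset.filter_map]
    have h2 : Finset.univ.val.filter ((fun x : ℂ => x ≠ 0) ∘ fun i => (hH.eigenvalues i : ℂ)) =
        (Finset.univ.filter fun i => hH.eigenvalues i ≠ 0).val := by
      rw [Finset.filter_val]
      congr 1
      ext i
      simp
    rw [h2, ← Finset.subtype_map, Finset.map_val, Multiset.map_map, Finset.subtype_univ]
    rfl
  · exact lt_of_le_of_ne (hM.eigenvalues_nonneg _) (e.symm (Tuple.sort b₀ k)).2.symm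

lemma Matrix.det_one_sub_smul_eq_prod_roots {n : Type*} [Fintype n] [DecidableEq n]
    (A : Matrix n n ℂ) (t : ℂ) :
    (1 - t • A).det = (A.charpoly.roots.map fun x => 1 - t * x).prod := by
  rcases eq_or_ne t 0 with rfl | ht
  · simp
  have hs := IsAlgClosed.splits A.charpoly
  have hprod := hs.eq_prod_roots_of_monic A.charpoly_monic
  have hcard : A.charpoly.roots.card = Fintype.card n := by
    rw [← hs.natDegree_eq_card_roots, Matrix.charpoly_natDegree_eq_dim]
  have h1 : (1 - t • A) = t • (Matrix.scalar n t⁻¹ - A) := by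
    rw [smul_sub, Matrix.scalar_apply, ← Matrix.smul_one_eq_diagonal, smul_smul, mul_inv_cancel₀ ht,
      one_smul]
  rw [h1, Matrix.det_smul, ← Matrix.eval_charpoly]
  conv_lhs => rw [hprod]
  have h2 : t ^ A.charpoly.roots.card = (A.charpoly.roots.map fun _ => t).prod := by simp
  rw [eval_multiset_prod, Multiset.map_map, ← hcard, h2, ← Multiset.prod_map_mul]
  congr 1
  refine Multiset.map_congr rfl fun x _ => ?_
  simp only [Function.comp_apply, eval_sub, eval_X, eval_C]
  field_simp

lemma ListsNonzeroEigenvalues.det_one_sub_smul {N r : ℕ} {M : Matrix (Fin N) (Fin N) ℝ}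
    {b : Fin r → ℝ} (hb : ListsNonzeroEigenvalues M b) (t : ℂ) :
    (1 - t • complexify M).det = ∏ k, (1 - t * b k) := by
  rw [Matrix.det_one_sub_smul_eq_prod_roots,
    ← Multiset.filter_add_not (fun x => x ≠ 0) (complexify M).charpoly.roots, Multiset.map_add,
    Multiset.prod_add, ← hb.2, Multiset.map_map]
  have h1 : ((Multiset.filter (fun a => ¬a ≠ 0) (complexify M).charpoly.roots).map
      fun x => 1 - t * x).prod = 1 := by
    refine Multiset.prod_eq_one fun y hy => ?_
    obtain ⟨x, hx, rfl⟩ := Multiset.mem_map.1 hy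
    have := (Multiset.mem_filter.1 hx).2
    rw [not_not] at this
    simp [this]
  rw [h1, mul_one]
  rfl

lemma ListsNonzeroEigenvalues.card_filter {N r : ℕ} {M : Matrix (Fin N) (Fin N) ℝ}
    {b : Fin r → ℝ} (hb : ListsNonzeroEigenvalues M b) :
    ((complexify M).charpoly.roots.filter fun x => x ≠ 0).card = r := by
  rw [← hb.2]
  simp

variable {N : ℕ} {α η θ R : Matrix (Fin N) (Fin N) ℝ}

lemma Kq_mul_self (hη : η.PosDef) : Kq η * Kq η = η :=
  CFC.sqrt_mul_sqrt_self η hη.posSemidef.nonneg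

lemma Kq_transpose (η : Matrix (Fin N) (Fin N) ℝ) : (Kq η)ᵀ = Kq η := by
  have := (Matrix.nonneg_iff_posSemidef.1 (CFC.sqrt_nonneg η)).isHermitian
  rwa [Matrix.IsHermitian, Matrix.conjTranspose_eq_transpose_of_trivial] at this

lemma Kp_transpose (α : Matrix (Fin N) (Fin N) ℝ) : (Kp α)ᵀ = Kp α := by
  change ((Kq α)⁻¹)ᵀ = (Kq α)⁻¹
  rw [Matrix.transpose_nonsing_inv, Kq_transpose]

lemma isUnit_det_Kq (hα : α.PosDef) : IsUnit (Kq α).det := by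
  have h := hα.isUnit
  rw [Matrix.isUnit_iff_isUnit_det, ← Kq_mul_self hα, Matrix.det_mul] at h
  exact isUnit_of_mul_isUnit_left h

lemma isUnit_det_Kp (hα : α.PosDef) : IsUnit (Kp α).det :=
  Matrix.isUnit_nonsing_inv_det _ (isUnit_det_Kq hα)

lemma Kp_mul_mul_Kp_transpose (hα : α.PosDef) : Kp α * α * (Kp α)ᵀ = 1 := by
  rw [Kp_transpose]
  conv_lhs => enter [1, 2]; rw [← Kq_mul_self hα]
  change (Kq α)⁻¹ * (Kq α * Kq α) * (Kq α)⁻¹ = 1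
  rw [← mul_assoc, Matrix.nonsing_inv_mul _ (isUnit_det_Kq hα), one_mul,
    Matrix.mul_nonsing_inv _ (isUnit_det_Kq hα)]

lemma rank_Kp_mul_mul_Kp_transpose (hα : α.PosDef) (R : Matrix (Fin N) (Fin N) ℝ) :
    (Kp α * R * (Kp α)ᵀ).rank = R.rank := by
  rw [Kp_transpose, Matrix.rank_mul_eq_left_of_isUnit_det _ _ (isUnit_det_Kp hα),
    Matrix.rank_mul_eq_right_of_isUnit_det _ _ (isUnit_det_Kp hα)]

lemma posSemidef_Kp_mul_mul_Kp_transpose (α : Matrix (Fin N) (Fin N) ℝ) (hR : R.PosSemidef) :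
    (Kp α * R * (Kp α)ᵀ).PosSemidef := by
  have := hR.mul_mul_conjTranspose_same (Kp α)
  rwa [Matrix.conjTranspose_eq_transpose_of_trivial] at this

lemma Phi_transpose_mul_Phi (α : Matrix (Fin N) (Fin N) ℝ) (hη : η.PosDef) :
    (Phi α η)ᵀ * Phi α η = Kp α * η * (Kp α)ᵀ := by
  rw [Phi, Matrix.transpose_mul, Matrix.transpose_transpose, Kq_transpose]
  conv_rhs => rw [← Kq_mul_self hη]
  simp only [mul_assoc]

/-- Here `Kp η` is `η^(-1/2)`. Cyclic invariance of the characteristic polynomial moves one factor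
across and leaves a positive semidefinite matrix of the same rank as `R`. -/
lemma exists_listsNonzeroEigenvalues_inv_mul (hη : η.PosDef) (hR : R.PosSemidef) :
    ∃ b : Fin R.rank → ℝ, ListsNonzeroEigenvalues (η⁻¹ * R) b ∧ ∀ k, 0 < b k := by
  have h := (posSemidef_Kp_mul_mul_Kp_transpose η hR).exists_listsNonzeroEigenvalues
  rw [rank_Kp_mul_mul_Kp_transpose hη] at h
  obtain ⟨b, hb, hb0⟩ := h
  refine ⟨b, ⟨hb.1, ?_⟩, hb0⟩
  rw [hb.2]
  have h1 : η⁻¹ = Kp η * Kp η := by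
    conv_lhs => rw [← Kq_mul_self hη, Matrix.mul_inv_rev]
    rfl
  have h2 : (complexify (Kp η * R * (Kp η)ᵀ)).charpoly = (complexify (η⁻¹ * R)).charpoly := by
    rw [h1, Kp_transpose, complexify_mul, Matrix.charpoly_mul_comm, ← complexify_mul, mul_assoc]
  rw [h2]

lemma isHermitian_frequencyOperator (α η : Matrix (Fin N) (Fin N) ℝ) (hθ : θᵀ = -θ) :
    (frequencyOperator α η θ).IsHermitian := by
  have h1 : (Kp α * θ * (Kp α)ᵀ)ᵀ = -(Kp α * θ * (Kp α)ᵀ) := by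
    simp only [Matrix.transpose_mul, Matrix.transpose_transpose, hθ]
    simp [mul_assoc]
  rw [frequencyOperator, Matrix.IsHermitian, Matrix.fromBlocks_conjTranspose]
  simp only [Matrix.conjTranspose_smul, complexify_conjTranspose, h1, complexify_neg,
    Matrix.transpose_transpose, Matrix.conjTranspose_zero]
  congr 1 <;> simp

lemma isHermitian_dissipationOperator (α : Matrix (Fin N) (Fin N) ℝ) (hR : R.PosSemidef) :
    (dissipationOperator α R).IsHermitian := by
  have h1 := (posSemidef_Kp_mul_mul_Kp_transpose α hR).isHermitian
  rw [Matrix.IsHermitian, Matrix.conjTranspose_eq_transpose_of_trivial] at h1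
  rw [dissipationOperator, Matrix.IsHermitian, Matrix.fromBlocks_conjTranspose]
  simp only [complexify_conjTranspose, h1, Matrix.conjTranspose_zero]

lemma card_nonzero_roots_charpoly_dissipationOperator (hα : α.PosDef) (hR : R.PosSemidef) :
    ((dissipationOperator α R).charpoly.roots.filter fun x => x ≠ 0).card = R.rank := by
  obtain ⟨b, hb, -⟩ := (posSemidef_Kp_mul_mul_Kp_transpose α hR).exists_listsNonzeroEigenvalues
  rw [dissipationOperator, Matrix.charpoly_fromBlocks_zero₁₂, roots_mul, Multiset.filter_add,
    Multiset.card_add, hb.card_filter, rank_Kp_mul_mul_Kp_transpose hα]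
  · simp [Multiset.filter_nsmul, Multiset.filter_singleton]
  · exact mul_ne_zero (Matrix.charpoly_monic _).ne_zero (Matrix.charpoly_monic _).ne_zero

/-- The characteristic polynomial of the system operator in terms of the quadratic pencil of the
Lagrangian system. -/
lemma eval_charpoly_systemOperator (hα : α.PosDef) (hη : η.PosDef) (β : ℝ) {ζ : ℂ} (hζ : ζ ≠ 0) :
    (systemOperator α η θ R β).charpoly.eval ζ = ((Kp α).det : ℂ) ^ 2 *
      (ζ ^ 2 • complexify α + (Complex.I * ζ) • (2 • complexify θ + (β : ℂ) • complexify R) -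
        complexify η).det := by
  set K := complexify (Kp α) with hK
  have hsc : Matrix.scalar (Fin N ⊕ Fin N) ζ - systemOperator α η θ R β =
      Matrix.fromBlocks
        (ζ • 1 + (2 * Complex.I) • complexify (Kp α * θ * (Kp α)ᵀ) +
          (Complex.I * β) • complexify (Kp α * R * (Kp α)ᵀ))
        (Complex.I • complexify (Phi α η)ᵀ) (-(Complex.I • complexify (Phi α η))) (ζ • 1) := by
    rw [systemOperator, frequencyOperator, dissipationOperator, Matrix.scalar_apply,
      ← Matrix.smul_one_eq_diagonal, ← Matrix.fromBlocks_one, Matrix.fromBlocks_smul,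
      Matrix.fromBlocks_smul, sub_eq_add_neg, sub_eq_add_neg, Matrix.fromBlocks_neg,
      Matrix.fromBlocks_add, Matrix.fromBlocks_neg, Matrix.fromBlocks_add]
    congr 1
    · module
    · simp
    · simp
    · simp
  -- The Schur complement is taken with respect to the lower right block `ζ • 1`. Multiplying it by
  -- `ζ` gives the pencil conjugated by `K` and `Kᵀ`, since `K α Kᵀ = 1`.
  let _ : Invertible (ζ • (1 : Matrix (Fin N) (Fin N) ℂ)) :=
    ⟨ζ⁻¹ • 1, by simp [smul_smul, hζ], by simp [smul_smul, hζ]⟩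
  have hinv : ⅟(ζ • (1 : Matrix (Fin N) (Fin N) ℂ)) = ζ⁻¹ • 1 := rfl
  rw [Matrix.eval_charpoly, hsc, Matrix.det_fromBlocks₂₂, hinv, ← Matrix.det_mul]
  have h1 : complexify (Phi α η)ᵀ * complexify (Phi α η) = K * complexify η * Kᵀ := by
    rw [← complexify_mul, Phi_transpose_mul_Phi α hη, complexify_mul, complexify_mul]
    rfl
  have h2 : K * complexify α * Kᵀ = 1 := by
    rw [hK, ← complexify_transpose, ← complexify_mul, ← complexify_mul, Kp_mul_mul_Kp_transpose hα,
      complexify_one]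
  have hd : ((Kp α).det : ℂ) = K.det := (det_complexify _).symm
  have hd' : K.det ^ 2 = K.det * Kᵀ.det := by rw [Matrix.det_transpose, sq]
  have h3 : ∀ M : Matrix (Fin N) (Fin N) ℝ,
      complexify (Kp α * M * (Kp α)ᵀ) = K * complexify M * Kᵀ := by
    intro M
    rw [complexify_mul, complexify_mul]
    rfl
  rw [hd, hd', mul_right_comm, ← Matrix.det_mul, ← Matrix.det_mul, h3, h3]
  congr 1
  rw [Matrix.smul_mul, one_mul, Matrix.mul_smul, mul_one, Matrix.smul_mul, Matrix.mul_neg,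
    Matrix.smul_mul, Matrix.mul_smul, h1, smul_sub, smul_neg, smul_neg, smul_smul, smul_smul,
    smul_smul, mul_sub, mul_add, sub_mul, add_mul]
  simp only [Matrix.mul_smul, Matrix.smul_mul, mul_add, add_mul, h2, smul_add, smul_smul]
  rw [mul_inv_cancel₀ hζ, one_mul, Complex.I_mul_I]
  module

end RealMatrices

/-! ### Existence of high-loss eigenpairs -/

section Existence
open Polynomial

lemma AnalyticAt.exists_eq_mul_of_apply_zero {f : ℂ → ℂ} (hf : AnalyticAt ℂ f 0) (h0 : f 0 = 0) :
    ∃ h : ℂ → ℂ, AnalyticAt ℂ h 0 ∧ ∀ᶠ z in 𝓝 0, f z = z * h z := by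
  have h1 : ((1 : ℕ) : ℕ∞) ≤ analyticOrderAt f 0 := by
    rw [Nat.cast_one, Order.one_le_iff_ne_zero]
    exact hf.analyticOrderAt_ne_zero.2 h0
  obtain ⟨h, hh, hfh⟩ := (natCast_le_analyticOrderAt hf).1 h1
  exact ⟨h, hh, by simpa using hfh⟩

lemma tendsto_inv_ofReal_atTop : Tendsto (fun β : ℝ => (β : ℂ)⁻¹) atTop (𝓝[≠] 0) := by
  refine tendsto_nhdsWithin_iff.2 ⟨?_, ?_⟩
  · simp only [← Complex.ofReal_inv]
    exact (Complex.continuous_ofReal.tendsto' 0 0 (by simp)).comp tendsto_inv_atTop_zero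
  · filter_upwards [eventually_gt_atTop 0] with β hβ
    simpa using hβ.ne'

lemma tendsto_I_mul_inv_ofReal_atTop :
    Tendsto (fun β : ℝ => Complex.I * (β : ℂ)⁻¹) atTop (𝓝[≠] 0) := by
  have h := tendsto_nhdsWithin_iff.1 tendsto_inv_ofReal_atTop
  refine tendsto_nhdsWithin_iff.2 ⟨?_, ?_⟩
  · simpa using h.1.const_mul Complex.I
  · filter_upwards [h.2] with β hβ
    simpa using hβ

lemma AnalyticAt.comp_I_mul {E : Type*} [NormedAddCommGroup E] [NormedSpace ℂ E] {f : ℂ → E}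
    (hf : AnalyticAt ℂ f 0) : AnalyticAt ℂ (fun z => f (Complex.I * z)) 0 := by
  have h : AnalyticAt ℂ (fun z : ℂ => Complex.I * z) 0 := by fun_prop
  exact AnalyticAt.fun_comp (by simpa using hf) h

variable {N : ℕ} {α η θ R : Matrix (Fin N) (Fin N) ℝ}

lemma exists_isHighLossEigenbasis (hα : α.PosDef) (hθ : θᵀ = -θ) (hR : R.PosSemidef) :
    ∃ (ζ : Fin (2 * N) → ℝ → ℂ) (w : Fin (2 * N) → ℝ → Fin N ⊕ Fin N → ℂ),
        IsHighLossEigenbasis α η θ R ζ w := by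
  classical
  set Ω := frequencyOperator α η θ with hΩ
  set B := dissipationOperator α R with hB
  set T : ℂ → Matrix (Fin N ⊕ Fin N) (Fin N ⊕ Fin N) ℂ := fun z => B + z • Ω with hT
  have hTa : ∀ i j, AnalyticAt ℂ (fun z => T z i j) 0 := fun i j => by
    simp only [hT, Matrix.add_apply, Matrix.smul_apply, smul_eq_mul]
    fun_prop
  obtain ⟨μ, v, hμ, hv, heig, hli⟩ := exists_analytic_eigenbasis hTa fun x => by
    have hΩH := isHermitian_frequencyOperator α η hθ
    have hBH := isHermitian_dissipationOperator α hR
    simp only [hT, Matrix.IsHermitian, Matrix.conjTranspose_add, Matrix.conjTranspose_smul]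
    rw [hΩ, hB, hΩH, hBH]
    simp
  have hspan : ∀ z, LinearIndependent ℂ (fun i => v i z) →
      Submodule.span ℂ (Set.range fun i => v i z) = ⊤ := fun z h =>
    h.span_eq_top_of_card_eq_finrank' (by simp)
  -- The eigenvectors may become dependent at `z = 0`, so the factorization is obtained as a limit
  -- from `z ≠ 0`.
  have hchar : B.charpoly = ∏ i, (X - C (μ i 0)) := by
    refine Polynomial.funext fun x => ?_
    have h1 : Tendsto (fun z => (T z).charpoly.eval x) (𝓝[≠] 0) (𝓝 (B.charpoly.eval x)) := by
      have hc : Continuous fun z => (T z).charpoly.eval x := by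
        simp only [Matrix.eval_charpoly, hT]
        fun_prop
      have : T 0 = B := by simp [hT]
      rw [← this]
      exact (hc.tendsto 0).mono_left nhdsWithin_le_nhds
    have h2 : Tendsto (fun z => ∏ i, (x - μ i z)) (𝓝[≠] 0) (𝓝 (∏ i, (x - μ i 0))) :=
      tendsto_finsetProd _ fun i _ => tendsto_const_nhds.sub
        ((hμ i).continuousAt.tendsto.mono_left nhdsWithin_le_nhds)
    rw [tendsto_nhds_unique h1 (h2.congr' ?_), eval_prod]
    · simp
    · filter_upwards [hli, nhdsWithin_le_nhds heig] with z hz hz'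
      rw [Matrix.charpoly_eq_prod_of_eigenbasis hz (hspan z hz) hz', eval_prod]
      simp
  have hcard : Fintype.card {i // μ i 0 ≠ 0} = R.rank := by
    rw [← card_nonzero_roots_charpoly_dissipationOperator hα hR, ← hB, hchar,
      roots_prod_univ_X_sub_C, Multiset.filter_map, Multiset.card_map, Fintype.card_subtype]
    rfl
  have hrank : R.rank ≤ 2 * N := (Matrix.rank_le_width R).trans (by omega)
  let e₀ : Fin (2 * N) ≃ Fin N ⊕ Fin N := Fintype.equivOfCardEq (by simp; omega)
  -- Renumbering that gives the first `R.rank` indices to the branches with `μ(0) ≠ 0`, which are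
  -- the ones with a pole.
  let e₁ : {j : Fin (2 * N) // (j : ℕ) < R.rank} ≃ {j : Fin (2 * N) // μ (e₀ j) 0 ≠ 0} := by
    refine Fintype.equivOfCardEq ?_
    rw [Fintype.card_fin_lt_of_le hrank, ← hcard]
    exact (Fintype.card_congr (e₀.subtypeEquiv fun _ => Iff.rfl)).symm
  let e : Fin (2 * N) ≃ Fin N ⊕ Fin N := e₁.extendSubtype.trans e₀
  have he1 : ∀ j : Fin (2 * N), (j : ℕ) < R.rank → μ (e j) 0 ≠ 0 := fun j hj =>
    e₁.extendSubtype_mem j hj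
  have he2 : ∀ j : Fin (2 * N), R.rank ≤ (j : ℕ) → μ (e j) 0 = 0 := fun j hj =>
    not_not.1 (e₁.extendSubtype_not_mem j (not_lt.2 hj))
  refine ⟨fun j β => -(Complex.I * β) * μ (e j) (Complex.I * (β : ℂ)⁻¹),
    fun j β => v (e j) (Complex.I * (β : ℂ)⁻¹), ?_, ?_, ?_, ?_, ?_⟩
  · filter_upwards [tendsto_I_mul_inv_ofReal_atTop.eventually hli] with β hβ
    refine ⟨hβ.comp e e.injective, ?_⟩
    rw [← hspan _ hβ]
    congr 1
    exact e.surjective.range_comp fun i => v i (Complex.I * (β : ℂ)⁻¹)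
  · filter_upwards [(tendsto_I_mul_inv_ofReal_atTop.mono_right nhdsWithin_le_nhds).eventually heig,
      eventually_gt_atTop 0] with β hβ hβ0 j
    have hb : (β : ℂ) ≠ 0 := by exact_mod_cast hβ0.ne'
    have hA : systemOperator α η θ R β = (-(Complex.I * β)) • T (Complex.I * (β : ℂ)⁻¹) := by
      simp only [systemOperator, hT, smul_add, smul_smul]
      rw [show -(Complex.I * (β : ℂ)) * (Complex.I * (β : ℂ)⁻¹) = 1 by
        linear_combination (-(β : ℂ) * (β : ℂ)⁻¹) * Complex.I_mul_I + mul_inv_cancel₀ hb]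
      rw [one_smul, neg_smul, sub_eq_add_neg, add_comm]
    rw [hA, Matrix.smul_mulVec, hβ (e j), smul_smul]
  · exact fun j => ⟨_, (hv (e j)).comp_I_mul, Filter.Eventually.of_forall fun β => rfl⟩
  · intro j hj
    have ha := (hμ (e j)).comp_I_mul
    refine ⟨fun z => z ^ (-1 : ℤ) • (-Complex.I * μ (e j) (Complex.I * z)), ?_, ?_, ?_⟩
    · exact (MeromorphicAt.id 0).zpow (-1) |>.smul (analyticAt_const.mul ha).meromorphicAt
    · rw [(meromorphicOrderAt_eq_int_iff (n := -1) ?_).2]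
      · exact_mod_cast (by norm_num : (-1 : ℤ) < 0)
      · exact ⟨fun z => -Complex.I * μ (e j) (Complex.I * z), analyticAt_const.mul ha,
          by simpa using he1 j hj, by simp⟩
      · exact (MeromorphicAt.id 0).zpow (-1) |>.smul (analyticAt_const.mul ha).meromorphicAt
    · refine Filter.Eventually.of_forall fun β => ?_
      simp only [zpow_neg_one, inv_inv, smul_eq_mul]
      ring
  · intro j hj
    obtain ⟨h, hh, hμh⟩ := (hμ (e j)).exists_eq_mul_of_apply_zero (he2 j hj)
    refine ⟨_, hh.comp_I_mul, ?_⟩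
    filter_upwards [(tendsto_I_mul_inv_ofReal_atTop.mono_right nhdsWithin_le_nhds).eventually hμh,
      eventually_gt_atTop 0] with β hβ hβ0
    have hb : (β : ℂ) ≠ 0 := by exact_mod_cast hβ0.ne'
    rw [hβ, ← mul_assoc, show -(Complex.I * (β : ℂ)) * (Complex.I * (β : ℂ)⁻¹) = 1 by
      linear_combination (-(β : ℂ) * (β : ℂ)⁻¹) * Complex.I_mul_I + mul_inv_cancel₀ hb, one_mul]

end Existence

/-! ### Asymptotics of a given eigenbasis -/

section Asymptotics
open Polynomial

lemma exists_equiv_of_map_univ_eq {κ κ' γ : Type*} [Fintype κ] [Fintype κ'] {f : κ → γ}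
    {g : κ' → γ} (h : Finset.univ.val.map f = Finset.univ.val.map g) :
    ∃ e : κ ≃ κ', ∀ k, g (e k) = f k := by
  classical
  have hc : ∀ x, Nonempty ({k // f k = x} ≃ {k // g k = x}) := by
    intro x
    rw [← Fintype.card_eq, Fintype.card_subtype, Fintype.card_subtype]
    have := congrArg (Multiset.count x) h
    rw [Multiset.count_map, Multiset.count_map] at this
    simpa [Finset.card_def, Finset.filter_val, eq_comm] using this
  exact ⟨Equiv.ofFiberEquiv fun x => (hc x).some, fun k => Equiv.ofFiberEquiv_map _ k⟩

lemma prod_zpow_eq_zpow_sum {κ : Type*} (s : Finset κ) {a : ℂ} (ha : a ≠ 0) (n : κ → ℤ) :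
    ∏ i ∈ s, a ^ n i = a ^ ∑ i ∈ s, n i := by
  classical
  induction s using Finset.induction_on with
  | empty => simp
  | insert i s hi ih => rw [Finset.prod_insert hi, Finset.sum_insert hi, zpow_add₀ ha, ih]

lemma tendsto_ofReal_zpow_atTop {n : ℤ} (hn : n < 0) :
    Tendsto (fun β : ℝ => (β : ℂ) ^ n) atTop (𝓝 0) := by
  simp only [← Complex.ofReal_zpow]
  exact (Complex.continuous_ofReal.tendsto' 0 0 (by simp)).comp (tendsto_zpow_atTop_zero hn)

lemma eventually_ofReal_ne_zero_atTop : ∀ᶠ β : ℝ in atTop, (β : ℂ) ≠ 0 := by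
  filter_upwards [eventually_gt_atTop 0] with β hβ
  exact_mod_cast hβ.ne'

lemma tendsto_inv_ofReal_atTop_zero : Tendsto (fun β : ℝ => (β : ℂ)⁻¹) atTop (𝓝 0) :=
  tendsto_inv_ofReal_atTop.mono_right nhdsWithin_le_nhds

/-- A power of `β` which has a finite nonzero limit, up to a factor with a nonzero limit, is
constant. -/
lemma eq_zero_of_tendsto_zpow_mul {s : ℤ} {P : ℝ → ℂ} {x y : ℂ} (hx : x ≠ 0) (hy : y ≠ 0)
    (h1 : Tendsto P atTop (𝓝 x)) (h2 : Tendsto (fun β : ℝ => (β : ℂ) ^ s * P β) atTop (𝓝 y)) :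
    s = 0 := by
  rcases lt_trichotomy s 0 with h | h | h
  · have := (tendsto_ofReal_zpow_atTop h).mul h1
    rw [zero_mul] at this
    exact absurd (tendsto_nhds_unique h2 this) hy
  · exact h
  · have h3 := (tendsto_ofReal_zpow_atTop (neg_lt_zero.2 h)).mul h2
    rw [zero_mul] at h3
    refine absurd (tendsto_nhds_unique h1 (h3.congr' ?_)) hx
    filter_upwards [eventually_ofReal_ne_zero_atTop] with β hβ
    rw [← mul_assoc, ← zpow_add₀ hβ, neg_add_cancel, zpow_zero, one_mul]

lemma AnalyticAtInfty.exists_tendsto {E : Type*} [NormedAddCommGroup E] [NormedSpace ℂ E]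
    {f : ℝ → E} (hf : AnalyticAtInfty f) : ∃ ρ, Tendsto f atTop (𝓝 ρ) := by
  obtain ⟨g, hg, hfg⟩ := hf
  refine ⟨g 0, (hg.continuousAt.tendsto.comp tendsto_inv_ofReal_atTop_zero).congr' ?_⟩
  filter_upwards [hfg] with β hβ
  rw [hβ, Function.comp]

lemma AnalyticAtInfty.exists_isBigO {f : ℝ → ℂ} (hf : AnalyticAtInfty f)
    (h0 : Tendsto f atTop (𝓝 0)) :
    ∃ c : ℂ, (fun β : ℝ => f β - c * (β : ℂ)⁻¹) =O[atTop] fun β : ℝ => β ^ (-2 : ℤ) := by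
  obtain ⟨g, hg, hfg⟩ := hf
  have hg0 : g 0 = 0 := by
    refine tendsto_nhds_unique ((hg.continuousAt.tendsto.comp
      tendsto_inv_ofReal_atTop_zero).congr' ?_) h0
    filter_upwards [hfg] with β hβ
    rw [hβ, Function.comp]
  obtain ⟨h, hh, hgh⟩ := hg.exists_eq_mul_of_apply_zero hg0
  obtain ⟨k, hk, hhk⟩ := (hh.fun_sub (analyticAt_const (v := h 0))).exists_eq_mul_of_apply_zero
    (sub_self _)
  refine ⟨h 0, ?_⟩
  have h1 : (fun β : ℝ => f β - h 0 * (β : ℂ)⁻¹) =ᶠ[atTop]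
      fun β : ℝ => ((β ^ (-2 : ℤ) : ℝ) : ℂ) * k ((β : ℂ)⁻¹) := by
    filter_upwards [hfg, tendsto_inv_ofReal_atTop_zero.eventually hgh,
      tendsto_inv_ofReal_atTop_zero.eventually hhk] with β h1 h2 h3
    rw [h1, h2, mul_comm (h 0), ← mul_sub, h3, ← mul_assoc, ← sq, inv_pow, zpow_neg]
    norm_cast
  refine h1.trans_isBigO ?_
  have h2 : (fun β : ℝ => k ((β : ℂ)⁻¹)) =O[atTop] fun _ => (1 : ℝ) :=
    (hk.continuousAt.tendsto.comp tendsto_inv_ofReal_atTop_zero).isBigO_one ℝ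
  have h3 : (fun β : ℝ => ((β ^ (-2 : ℤ) : ℝ) : ℂ)) =O[atTop] fun β : ℝ => β ^ (-2 : ℤ) :=
    isBigO_of_le _ fun β => by rw [Complex.norm_real]
  simpa using h3.mul h2

lemma tendsto_mul_sub_of_isBigO {f : ℝ → ℂ} {c : ℂ}
    (h : (fun β : ℝ => f β - c * (β : ℂ)⁻¹) =O[atTop] fun β : ℝ => β ^ (-2 : ℤ)) (μ : ℂ) :
    Tendsto (fun β : ℝ => (β : ℂ) ^ (1 : ℤ) * (μ * (β : ℂ)⁻¹ - f β)) atTop (𝓝 (μ - c)) := by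
  have h1 : (fun β : ℝ => (β : ℂ) * (f β - c * (β : ℂ)⁻¹)) =O[atTop]
      fun β : ℝ => β ^ (-1 : ℤ) := by
    have h2 : (fun β : ℝ => (β : ℂ)) =O[atTop] fun β : ℝ => β :=
      isBigO_of_le _ fun β => by rw [Complex.norm_real]
    refine (h2.mul h).trans_eventuallyEq ?_
    filter_upwards [eventually_gt_atTop 0] with β hβ
    field_simp
  have h3 := (h1.trans_tendsto (tendsto_zpow_atTop_zero (by norm_num))).const_sub (μ - c)
  rw [sub_zero] at h3
  refine h3.congr' ?_
  filter_upwards [eventually_ofReal_ne_zero_atTop] with β hβ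
  field_simp
  ring

/-- The exponent is the (negative) order of the pole, so `β ^ n` also kills the term `μ / β` and the
limit does not depend on `μ`. -/
lemma HasPoleAtInfty.exists_tendsto {f : ℝ → ℂ} (hf : HasPoleAtInfty f) :
    ∃ (n : ℤ) (E : ℂ), E ≠ 0 ∧ ∀ μ : ℂ,
      Tendsto (fun β : ℝ => (β : ℂ) ^ n * (μ * (β : ℂ)⁻¹ - f β)) atTop (𝓝 E) := by
  obtain ⟨g, hg, hneg, hfg⟩ := hf
  obtain ⟨n, hn⟩ := WithTop.ne_top_iff_exists.1 (ne_top_of_lt hneg)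
  obtain ⟨h, hh, hh0, hgh⟩ := (meromorphicOrderAt_eq_int_iff hg).1 hn.symm
  have hn0 : n < 0 := by
    rw [← hn] at hneg
    exact_mod_cast hneg
  refine ⟨n, -h 0, neg_ne_zero.2 hh0, fun μ => ?_⟩
  have h1 : Tendsto (fun β : ℝ => (β : ℂ) ^ n * (μ * (β : ℂ)⁻¹) - h ((β : ℂ)⁻¹)) atTop
      (𝓝 (0 * (μ * 0) - h 0)) :=
    ((tendsto_ofReal_zpow_atTop hn0).mul (tendsto_inv_ofReal_atTop_zero.const_mul μ)).sub
      (hh.continuousAt.tendsto.comp tendsto_inv_ofReal_atTop_zero)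
  rw [zero_mul, zero_sub] at h1
  refine h1.congr' ?_
  filter_upwards [hfg, tendsto_inv_ofReal_atTop.eventually hgh,
    eventually_ofReal_ne_zero_atTop] with β h2 h3 h4
  rw [h2, h3, sub_zero, smul_eq_mul, mul_sub, ← mul_assoc ((β : ℂ) ^ n) ((β : ℂ)⁻¹ ^ n), inv_zpow,
    mul_inv_cancel₀ (zpow_ne_zero _ h4), one_mul]

variable {N : ℕ} {α η θ R : Matrix (Fin N) (Fin N) ℝ}
  {ζ : Fin (2 * N) → ℝ → ℂ} {w : Fin (2 * N) → ℝ → Fin N ⊕ Fin N → ℂ}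

/-- The rescaled characteristic polynomial of the system operator in the high-loss limit. -/
lemma tendsto_eval_charpoly_systemOperator (hα : α.PosDef) (hη : η.PosDef) {μ : ℂ} (hμ : μ ≠ 0) :
    Tendsto (fun β : ℝ => (systemOperator α η θ R β).charpoly.eval (μ * (β : ℂ)⁻¹)) atTop
      (𝓝 (((Kp α).det : ℂ) ^ 2 * ((Complex.I * μ) • complexify R - complexify η).det)) := by
  have hc : Continuous fun x : ℂ => ((Kp α).det : ℂ) ^ 2 *
      ((μ * x) ^ 2 • complexify α + (Complex.I * (μ * x)) • (2 • complexify θ) +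
        (Complex.I * μ) • complexify R - complexify η).det := by
    fun_prop
  have h1 := (hc.tendsto 0).comp tendsto_inv_ofReal_atTop_zero
  simp only [mul_zero, zero_smul, zero_add, ne_eq, OfNat.ofNat_ne_zero, not_false_eq_true,
    zero_pow] at h1
  refine h1.congr' ?_
  filter_upwards [eventually_ofReal_ne_zero_atTop] with β hβ
  rw [eval_charpoly_systemOperator hα hη β (mul_ne_zero hμ (inv_ne_zero hβ)), Function.comp,
    smul_add, smul_smul (Complex.I * (μ * (β : ℂ)⁻¹)) (β : ℂ),
    show Complex.I * (μ * (β : ℂ)⁻¹) * (β : ℂ) = Complex.I * μ by field_simp, ← add_assoc]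

lemma det_pencil_eq_prod (hη : η.PosDef) {r : ℕ} {b : Fin r → ℝ}
    (hb : ListsNonzeroEigenvalues (η⁻¹ * R) b) (hb0 : ∀ k, 0 < b k) (μ : ℂ) :
    ((Complex.I * μ) • complexify R - complexify η).det =
      ((-complexify η).det * ∏ k, (-Complex.I * b k)) *
        ∏ k, (μ - -Complex.I * ((1 / b k : ℝ) : ℂ)) := by
  have h1 : (Complex.I * μ) • complexify R - complexify η =
      (-complexify η) * (1 - (Complex.I * μ) • complexify (η⁻¹ * R)) := by
    have : complexify η * complexify (η⁻¹ * R) = complexify R := by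
      rw [← complexify_mul, ← mul_assoc, Matrix.mul_nonsing_inv _
        ((Matrix.isUnit_iff_isUnit_det _).1 hη.isUnit), one_mul]
    rw [mul_sub, mul_one, Matrix.mul_smul, neg_mul, this]
    module
  rw [h1, Matrix.det_mul, hb.det_one_sub_smul, mul_assoc, ← Finset.prod_mul_distrib]
  congr 1
  refine Finset.prod_congr rfl fun k _ => ?_
  have : (b k : ℂ) ≠ 0 := by exact_mod_cast (hb0 k).ne'
  push_cast
  field_simp
  linear_combination Complex.I_sq

/-- The low-loss eigenvalues which tend to zero, with their leading coefficients. -/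
lemma IsHighLossEigenbasis.exists_equiv (h : IsHighLossEigenbasis α η θ R ζ w)
    (hα : α.PosDef) (hη : η.PosDef) {b : Fin R.rank → ℝ}
    (hb : ListsNonzeroEigenvalues (η⁻¹ * R) b) (hb0 : ∀ k, 0 < b k) :
    ∃ e : Fin R.rank ≃ {j : Fin (2 * N) // R.rank ≤ (j : ℕ) ∧ Tendsto (ζ j) atTop (𝓝 0)},
      ∀ k, (fun β : ℝ => ζ (e k) β - (-Complex.I * ((1 / b k : ℝ) : ℂ) * (β : ℂ)⁻¹))
        =O[atTop] fun β : ℝ => β ^ (-2 : ℤ) := by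
  classical
  let Z : Fin (2 * N) → Prop := fun j => R.rank ≤ (j : ℕ) ∧ Tendsto (ζ j) atTop (𝓝 0)
  -- The exponent is `1` if `ζ j → 0` is low-loss, `0` for a nonzero low-loss limit, and the order
  -- of the pole otherwise. `E = 1` on `Z` and `c = 0` off `Z` are placeholders.
  have hcases : ∀ j, ∃ (n : ℤ) (E c : ℂ), E ≠ 0 ∧
      (Z j → (fun β : ℝ => ζ j β - c * (β : ℂ)⁻¹) =O[atTop] fun β : ℝ => β ^ (-2 : ℤ)) ∧
      ∀ μ : ℂ, Tendsto (fun β : ℝ => (β : ℂ) ^ n * (μ * (β : ℂ)⁻¹ - ζ j β)) atTop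
        (𝓝 (if Z j then μ - c else E)) := by
    intro j
    by_cases hj : Z j
    · obtain ⟨c, hc⟩ := (h.lowLoss j hj.1).exists_isBigO hj.2
      refine ⟨1, 1, c, one_ne_zero, fun _ => hc, fun μ => ?_⟩
      rw [if_pos hj]
      exact tendsto_mul_sub_of_isBigO hc μ
    · simp only [if_neg hj]
      rcases lt_or_ge (j : ℕ) R.rank with hlt | hge
      · obtain ⟨n, E, hE, hlim⟩ := (h.highLoss j hlt).exists_tendsto
        exact ⟨n, E, 0, hE, fun h' => absurd h' hj, hlim⟩
      · obtain ⟨ρ, hρ⟩ := (h.lowLoss j hge).exists_tendsto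
        refine ⟨0, -ρ, 0, neg_ne_zero.2 ?_, fun h' => absurd h' hj, fun μ => ?_⟩
        · rintro rfl
          exact hj ⟨hge, hρ⟩
        · simpa using (tendsto_inv_ofReal_atTop_zero.const_mul μ).sub hρ
  choose n E c hE hc hlim using hcases
  set x : Fin R.rank → ℂ := fun k => -Complex.I * ((1 / b k : ℝ) : ℂ) with hx
  set D : ℂ := ((Kp α).det : ℂ) ^ 2 * ((-complexify η).det * ∏ k, (-Complex.I * b k)) with hD
  set K : ℂ := ∏ j ∈ Finset.univ.filter (fun j => ¬ Z j), E j with hK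
  have hD0 : D ≠ 0 := by
    refine mul_ne_zero (pow_ne_zero _ ?_) (mul_ne_zero ?_ ?_)
    · exact_mod_cast (isUnit_det_Kp hα).ne_zero
    · rw [Matrix.det_neg, det_complexify]
      refine mul_ne_zero (pow_ne_zero _ (by norm_num)) ?_
      exact_mod_cast hη.det_pos.ne'
    · refine Finset.prod_ne_zero_iff.2 fun k _ => mul_ne_zero (by simp) ?_
      exact_mod_cast (hb0 k).ne'
  have hK0 : K ≠ 0 := Finset.prod_ne_zero_iff.2 fun j _ => hE j
  set d : ℂ[X] := C D * ∏ k, (X - C (x k)) with hd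
  set p : ℂ[X] := C K * ∏ j : {j // Z j}, (X - C (c j)) with hp
  have hd0 : d ≠ 0 := mul_ne_zero (C_ne_zero.2 hD0)
    (Finset.prod_ne_zero_iff.2 fun k _ => X_sub_C_ne_zero _)
  have hp0 : p ≠ 0 := mul_ne_zero (C_ne_zero.2 hK0)
    (Finset.prod_ne_zero_iff.2 fun k _ => X_sub_C_ne_zero _)
  have hlimd : ∀ μ : ℂ, μ ≠ 0 →
      Tendsto (fun β : ℝ => ∏ j, (μ * (β : ℂ)⁻¹ - ζ j β)) atTop (𝓝 (d.eval μ)) := by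
    intro μ hμ
    have h1 := tendsto_eval_charpoly_systemOperator (θ := θ) (R := R) hα hη hμ
    have h2 : d.eval μ =
        ((Kp α).det : ℂ) ^ 2 * ((Complex.I * μ) • complexify R - complexify η).det := by
      rw [det_pencil_eq_prod hη hb hb0, ← mul_assoc, hd, eval_mul, eval_C, eval_prod]
      simp only [hx, hD, eval_sub, eval_X, eval_C]
    rw [h2]
    refine h1.congr' ?_
    filter_upwards [h.basis, h.eigen] with β h3 h4
    rw [Matrix.charpoly_eq_prod_of_eigenbasis h3.1 h3.2 h4, eval_prod]
    simp
  have hlimp : ∀ μ : ℂ, Tendsto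
      (fun β : ℝ => (β : ℂ) ^ (∑ j, n j) * ∏ j, (μ * (β : ℂ)⁻¹ - ζ j β)) atTop
      (𝓝 (p.eval μ)) := by
    intro μ
    have h1 := tendsto_finsetProd Finset.univ fun j _ => hlim j μ
    have h2 : p.eval μ = ∏ j, if Z j then μ - c j else E j := by
      rw [Finset.prod_ite, ← hK, mul_comm, hp, eval_mul, eval_C, eval_prod]
      congr 1
      rw [← Finset.prod_subtype (Finset.univ.filter Z) (by simp)
        (fun j => eval μ (X - C (c j)))]
      simp
    rw [h2]
    refine h1.congr' ?_
    filter_upwards [eventually_ofReal_ne_zero_atTop] with β hβ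
    rw [Finset.prod_mul_distrib, prod_zpow_eq_zpow_sum _ hβ]
  -- At a point `μ` where `X`, `d` and `p` are all nonzero, both the product and its rescaling have
  -- nonzero limits.
  have hs : ∑ j, n j = 0 := by
    obtain ⟨μ, hμ⟩ : ∃ μ, (X * d * p).eval μ ≠ 0 := by
      by_contra! hcon
      exact mul_ne_zero (mul_ne_zero X_ne_zero hd0) hp0
        (Polynomial.funext fun μ => by rw [hcon μ, eval_zero])
    rw [eval_mul, eval_mul, eval_X] at hμ
    exact eq_zero_of_tendsto_zpow_mul (right_ne_zero_of_mul (left_ne_zero_of_mul hμ))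
      (right_ne_zero_of_mul hμ)
      (hlimd μ (left_ne_zero_of_mul (left_ne_zero_of_mul hμ))) (hlimp μ)
  clear_value d p
  have hdp : d = p := by
    -- The factor `X` absorbs `μ = 0`, where the limit `d` is not available.
    have : X * d = X * p := by
      refine Polynomial.funext fun μ => ?_
      rw [eval_mul, eval_mul, eval_X]
      rcases eq_or_ne μ 0 with rfl | hμ
      · simp
      · have h1 := hlimp μ
        simp only [hs, zpow_zero, one_mul] at h1
        rw [tendsto_nhds_unique (hlimd μ hμ) h1]
    exact mul_left_cancel₀ X_ne_zero this
  have hroots := congrArg Polynomial.roots hdp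
  rw [hd, hp, roots_C_mul _ hD0, roots_C_mul _ hK0, roots_prod_univ_X_sub_C,
    roots_prod_univ_X_sub_C fun j : {j // Z j} => c j] at hroots
  obtain ⟨e, he⟩ := exists_equiv_of_map_univ_eq hroots
  refine ⟨e, fun k => ?_⟩
  have h1 := hc (e k) (e k).2
  rw [he k] at h1
  exact h1

open scoped ComplexOrder in
lemma star_dotProduct_self_ne_zero {ι : Type*} [Fintype ι] {v : ι → ℂ} (hv : v ≠ 0) :
    star v ⬝ᵥ v ≠ 0 :=
  dotProduct_star_self_eq_zero.not.2 hv

/-- The limits of the low-loss eigenvalues are real. -/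
lemma IsHighLossEigenbasis.limit_real (h : IsHighLossEigenbasis α η θ R ζ w) (hθ : θᵀ = -θ)
    (hR : R.PosSemidef) (j : Fin (2 * N)) {ρ : ℂ} (hρ : Tendsto (ζ j) atTop (𝓝 ρ)) :
    (ρ.re : ℂ) = ρ := by
  set Ω := frequencyOperator α η θ with hΩ
  set B := dissipationOperator α R with hB
  have hΩH : Ωᴴ = Ω := isHermitian_frequencyOperator α η hθ
  have hBH : Bᴴ = B := isHermitian_dissipationOperator α hR
  obtain ⟨W, hW, hwW⟩ := h.analytic_vec j
  -- `W` may vanish at `0`; being nonzero as a germ, it can be divided by a power of `z` to get a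
  -- limiting vector `u 0 ≠ 0`.
  have hW0 : ¬ ∀ᶠ z in 𝓝 0, W z = 0 := by
    intro hz
    obtain ⟨β, h1, h2, h3⟩ := (h.basis.and (hwW.and
      (tendsto_inv_ofReal_atTop_zero.eventually hz))).exists
    exact h1.1.ne_zero j (h2.trans h3)
  obtain ⟨n, u, hu, hu0, hWu⟩ := hW.exists_eventuallyEq_pow_smul_nonzero_iff.2 hW0
  set v : ℝ → Fin N ⊕ Fin N → ℂ := fun β => u ((β : ℂ)⁻¹) with hv
  have hvlim : Tendsto v atTop (𝓝 (u 0)) :=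
    hu.continuousAt.tendsto.comp tendsto_inv_ofReal_atTop_zero
  have heig : ∀ᶠ β : ℝ in atTop,
      Ω *ᵥ v β - (Complex.I * β) • B *ᵥ v β = ζ j β • v β := by
    filter_upwards [h.eigen, hwW, tendsto_inv_ofReal_atTop_zero.eventually hWu,
      eventually_ofReal_ne_zero_atTop] with β h1 h2 h3 h4
    have h5 := h1 j
    rw [h2, h3, sub_zero, Matrix.mulVec_smul, smul_comm] at h5
    have h6 := smul_right_injective _ (pow_ne_zero n (inv_ne_zero h4)) h5
    rw [← h6, systemOperator, Matrix.sub_mulVec, Matrix.smul_mulVec]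
  have hmul : ∀ M : Matrix (Fin N ⊕ Fin N) (Fin N ⊕ Fin N) ℂ,
      Tendsto (fun β => M *ᵥ v β) atTop (𝓝 (M *ᵥ u 0)) := fun M =>
    ((Continuous.matrix_mulVec continuous_const continuous_id).tendsto (u 0)).comp hvlim
  -- Divide the eigenvalue equation by `β`: all terms but the dissipative one tend to zero, as `ζ j`
  -- is bounded.
  have hBu : B *ᵥ u 0 = 0 := by
    have h1 : Tendsto (fun β : ℝ => ((β : ℂ)⁻¹ * -Complex.I) • (Ω *ᵥ v β - ζ j β • v β)) atTop
        (𝓝 ((0 * -Complex.I) • (Ω *ᵥ u 0 - ρ • u 0))) :=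
      (tendsto_inv_ofReal_atTop_zero.mul_const _).smul ((hmul Ω).sub (hρ.smul hvlim))
    rw [zero_mul, zero_smul] at h1
    refine tendsto_nhds_unique (hmul B) (h1.congr' ?_)
    filter_upwards [heig, eventually_ofReal_ne_zero_atTop] with β h2 h3
    rw [← h2, sub_sub_cancel, smul_smul,
      show (β : ℂ)⁻¹ * -Complex.I * (Complex.I * β) = 1 by
        field_simp; linear_combination -Complex.I_sq, one_smul]
  have hquad : star (u 0) ⬝ᵥ (Ω *ᵥ u 0) = ρ * (star (u 0) ⬝ᵥ u 0) := by
    have hdot : ∀ {f : ℝ → Fin N ⊕ Fin N → ℂ} {y}, Tendsto f atTop (𝓝 y) →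
        Tendsto (fun β => star (u 0) ⬝ᵥ f β) atTop (𝓝 (star (u 0) ⬝ᵥ y)) := fun {f y} hf =>
      ((Continuous.dotProduct continuous_const continuous_id).tendsto y).comp hf
    refine tendsto_nhds_unique (hdot (hmul Ω)) ((hρ.mul (hdot hvlim)).congr' ?_)
    -- Pairing with `u 0` removes the term with the factor `β` exactly, since `B` is Hermitian and
    -- `B (u 0) = 0`.
    filter_upwards [heig] with β h1
    have h2 : star (u 0) ⬝ᵥ (B *ᵥ v β) = 0 := by
      rw [Matrix.dotProduct_mulVec, ← hBH, ← Matrix.star_mulVec, hBu, star_zero, zero_dotProduct]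
    rw [← smul_eq_mul, ← dotProduct_smul, ← h1, dotProduct_sub, dotProduct_smul, h2, smul_zero,
      sub_zero]
  have hpos := star_dotProduct_self_ne_zero hu0
  have hstar1 : star (star (u 0) ⬝ᵥ (Ω *ᵥ u 0)) = star (u 0) ⬝ᵥ (Ω *ᵥ u 0) := by
    rw [← Matrix.star_dotProduct_star, star_star, Matrix.star_mulVec, hΩH,
      Matrix.dotProduct_mulVec, dotProduct_comm]
  have hstar2 : star (star (u 0) ⬝ᵥ u 0) = star (u 0) ⬝ᵥ u 0 := by
    rw [← Matrix.star_dotProduct_star, star_star, dotProduct_comm]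
  rw [hquad, star_mul', hstar2] at hstar1
  exact Complex.conj_eq_iff_re.1 (mul_right_cancel₀ hpos hstar1)

end Asymptotics

end

/-! ### Assembly: the reindexing permutation -/

theorem mainTheorem12 (N : ℕ) (α η θ R : Matrix (Fin N) (Fin N) ℝ)
    (hα : α.PosDef) (hη : η.PosDef) (hθ : θᵀ = -θ) (hR : R.PosSemidef) (hR0 : 0 < R.rank) :
    ∃ b : Fin R.rank → ℝ,
      ListsNonzeroEigenvalues (η⁻¹ * R) b ∧ (∀ k, 0 < b k) ∧
      (∃ (ζ : Fin (2 * N) → ℝ → ℂ) (w : Fin (2 * N) → ℝ → Fin N ⊕ Fin N → ℂ),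
        IsHighLossEigenbasis α η θ R ζ w) ∧
      ∀ (ζ : Fin (2 * N) → ℝ → ℂ) (w : Fin (2 * N) → ℝ → Fin N ⊕ Fin N → ℂ),
        IsHighLossEigenbasis α η θ R ζ w →
        ∃ σ : Equiv.Perm (Fin (2 * N)),
          (∀ j : Fin (2 * N), (j : ℕ) < R.rank → σ j = j) ∧
          (∀ (j : Fin (2 * N)) (_ : R.rank ≤ (j : ℕ)) (_ : (j : ℕ) < 2 * R.rank),
            Tendsto (ζ (σ j)) atTop (𝓝 0) ∧
            (fun β : ℝ => ζ (σ j) β -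
                (-Complex.I * ((1 / b ⟨(j : ℕ) - R.rank, by omega⟩ : ℝ) : ℂ) * (β : ℂ)⁻¹))
              =O[atTop] fun β : ℝ => β ^ (-2 : ℤ)) ∧
          (∀ j : Fin (2 * N), 2 * R.rank ≤ (j : ℕ) →
            ∃ ρ : ℝ, ρ ≠ 0 ∧ Tendsto (ζ (σ j)) atTop (𝓝 (ρ : ℂ))) := by
  classical
  obtain ⟨b, hb, hb0⟩ := exists_listsNonzeroEigenvalues_inv_mul hη hR
  refine ⟨b, hb, hb0, exists_isHighLossEigenbasis hα hθ hR, fun ζ w h => ?_⟩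
  obtain ⟨e, he⟩ := h.exists_equiv hα hη hb hb0
  let J := {j : Fin (2 * N) // (j : ℕ) < 2 * R.rank}
  -- High-loss indices stay fixed and the next `R.rank` indices enumerate the eigenvalues tending to
  -- zero; `σ` is any extension of this injection to a permutation.
  let f : J → Fin (2 * N) := fun j =>
    if hj : (j : ℕ) < R.rank then j else e ⟨(j : ℕ) - R.rank, by have := j.2; omega⟩
  have hf1 : ∀ j : J, (j : ℕ) < R.rank → f j = j := fun j hj => dif_pos hj
  have hf2 : ∀ (j : J) (hj : ¬ (j : ℕ) < R.rank),
      f j = e ⟨(j : ℕ) - R.rank, by have := j.2; omega⟩ := fun j hj => dif_neg hj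
  have hfge : ∀ j : J, ¬ (j : ℕ) < R.rank → R.rank ≤ (f j : ℕ) := fun j hj => by
    rw [hf2 j hj]
    exact (e _).2.1
  have hinj : Function.Injective f := by
    intro i j hij
    by_cases hi : (i : ℕ) < R.rank <;> by_cases hj : (j : ℕ) < R.rank
    · rw [hf1 i hi, hf1 j hj] at hij
      exact Subtype.ext hij
    · have := hfge j hj
      rw [← hij, hf1 i hi] at this
      omega
    · have := hfge i hi
      rw [hij, hf1 j hj] at this
      omega
    · rw [hf2 i hi, hf2 j hj] at hij
      have := congrArg Fin.val (e.injective (Subtype.ext hij))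
      simp only at this
      exact Subtype.ext (Fin.ext (by omega))
  let σ : Equiv.Perm (Fin (2 * N)) := (Equiv.ofInjective f hinj).extendSubtype
  have hσ : ∀ (j : Fin (2 * N)) (hj : (j : ℕ) < 2 * R.rank), σ j = f ⟨j, hj⟩ := fun j hj =>
    (Equiv.ofInjective f hinj).extendSubtype_apply_of_mem j hj
  have hσ1 : ∀ j : Fin (2 * N), (j : ℕ) < R.rank → σ j = j := fun j hj =>
    (hσ j (by omega)).trans (hf1 ⟨j, by omega⟩ hj)
  refine ⟨σ, hσ1, fun j hj1 hj2 => ?_, fun j hj => ?_⟩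
  · have h1 : σ j = e ⟨(j : ℕ) - R.rank, by omega⟩ :=
      (hσ j hj2).trans (hf2 ⟨j, hj2⟩ (not_lt.2 hj1))
    rw [h1]
    exact ⟨(e _).2.2, he _⟩
  · have hnot : σ j ∉ Set.range f :=
      (Equiv.ofInjective f hinj).extendSubtype_not_mem j (not_lt.2 hj)
    have hge : R.rank ≤ (σ j : ℕ) := by
      by_contra! hlt
      exact hnot ⟨⟨σ j, by omega⟩, hf1 _ hlt⟩
    obtain ⟨ρ, hρ⟩ := (h.lowLoss _ hge).exists_tendsto
    have hre := h.limit_real hθ hR _ hρ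
    -- A zero limit would put `σ j` among the values of `e`, hence in the range of `f`, which is
    -- already used up by the indices below `2 * R.rank`.
    refine ⟨ρ.re, fun h0 => hnot ?_, by rwa [hre]⟩
    rw [h0, Complex.ofReal_zero] at hre
    rw [← hre] at hρ
    set k := e.symm ⟨σ j, hge, hρ⟩ with hk
    have hrank := R.rank_le_width
    refine ⟨⟨⟨R.rank + k, by omega⟩, by simp only; omega⟩, ?_⟩
    rw [hf2 _ (by simp)]
    have h2 : (⟨R.rank + (k : ℕ) - R.rank, by omega⟩ : Fin R.rank) = k :=
      Fin.ext (by simp)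
    simp only [h2]
    rw [hk, Equiv.apply_symm_apply]
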